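/- Let $D=[-1,1]^d$, $d\ge 1$, and write $(z)_+=\max(0,z)$ and $\|\omega\|_1=\sum_i|\omega_i|$. There is a universal constant $c>0$, independent of $d$, $f$ and $m$, such that the following holds. Let $f$ be a real-valued function that admits a Fourier representation $f(x)=\int_{\mathbb{R}^d}e^{ix\cdot\omega}\mathcal{F}(f)(\omega)\,d\omega$ for $x\in D$, where $\mathcal{F}(f):\mathbb{R}^d\to\mathbb{C}$ is integrable, and suppose that $$v_{f,2}=\int_{\mathbb{R}^d}\|\omega\|_1^2\,|\mathcal{F}(f)(\omega)|\,d\omega<\infty .$$ Then $f$ is differentiable at $0$ and there is a number $v$ with $0\le v\le 2v_{f,2}$ such that, for every integer $m\ge1$, there are $b_k\in[-1,1]$, $a_k\in\mathbb{R}^d$ with $\|a_k\|_1=1$, and $t_k\in[0,1]$ ($k=1,\dots,m$) for which $$f_m(x)=f(0)+\nabla f(0)\cdot x+\frac{v}{m}\sum_{k=1}^m b_k\,(a_k\cdot x-t_k)_+$$ satisfies $$\sup_{x\in D}|f(x)-f_m(x)|\le c\,v_{f,2}\,\sqrt{d+\log m}\;m^{-1/2-1/d}.$$ Furthermore, there are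 also $b_k\in\{-1,1\}$, $a_k$ with $\|a_k\|_1=1$ and $t_k\in[0,1]$ ($k=1,\dots,m$) such that the corresponding $f_m$ satisfies $$\sup_{x\in D}|f(x)-f_m(x)|\le c\,v_{f,2}\,\sqrt{d+\log m}\;m^{-1/2-1/(d+2)}.$$ -/

import Mathlib

namespace RidgeApprox

/-- The `ℓ¹` norm of a vector of `ℝ^d`. -/
noncomputable def l1Norm {d : ℕ} (w : EuclideanSpace ℝ (Fin d)) : ℝ :=
  ∑ i, |w i|

/-- The cube `D = [-1, 1]^d`. -/
def cube (d : ℕ) : Set (EuclideanSpace ℝ (Fin d)) :=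
  {x | ∀ i, x i ∈ Set.Icc (-1 : ℝ) 1}

/-- `f` has the Fourier representation `f x = ∫ exp (i x·ω) F ω dω` on the cube, the integral
being absolutely convergent. -/
structure HasFourierRep {d : ℕ} (f : EuclideanSpace ℝ (Fin d) → ℝ)
    (F : EuclideanSpace ℝ (Fin d) → ℂ) : Prop where
  integrable : MeasureTheory.Integrable F
  eq_integral : ∀ x ∈ cube d,
    (f x : ℂ) = ∫ w, Complex.exp (Complex.I * ((inner ℝ x w : ℝ) : ℂ)) * F w

/-- The integrand `‖ω‖₁^s |F ω|` of the spectral norm `v_{f,s}`. -/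
noncomputable def spectralDensity {d : ℕ} (s : ℕ) (F : EuclideanSpace ℝ (Fin d) → ℂ)
    (w : EuclideanSpace ℝ (Fin d)) : ℝ :=
  l1Norm w ^ s * ‖F w‖

/-- `v_{f,s} = ∫ ‖ω‖₁^s |F ω| dω` (meaningful when the integrand is integrable). -/
noncomputable def spectralNorm {d : ℕ} (s : ℕ) (F : EuclideanSpace ℝ (Fin d) → ℂ) : ℝ :=
  ∫ w, spectralDensity s F w

/-- The ReLU (ramp) activation `z ↦ (z)₊`. -/
def relu (z : ℝ) : ℝ := max 0 z

/-- The function `x ↦ b₀ + a₀·x + (v/m) ∑ₖ bₖ (aₖ·x - tₖ)₊`. -/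
noncomputable def rampNet {d m : ℕ} (b₀ : ℝ) (a₀ : EuclideanSpace ℝ (Fin d)) (v : ℝ)
    (b : Fin m → ℝ) (a : Fin m → EuclideanSpace ℝ (Fin d)) (t : Fin m → ℝ)
    (x : EuclideanSpace ℝ (Fin d)) : ℝ :=
  b₀ + inner ℝ a₀ x + v / m * ∑ k, b k * relu (inner ℝ (a k) x - t k)

end RidgeApprox

namespace RidgeApprox

open Finset

/-! ### Ridge functions -/

/-! Taylor's formula with integral remainder writes `cos (R u + φ)`, minus its affine part at `u =
0`, as `R ^ 2` times an integral over `t ∈ [0, 1]` of ramps `(±u - t)₊` with coefficients of modulus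
at most 1. Integrated against `F`, this puts `f(x) - f(0) - ∇f(0)·x` in `2 v_{f,2}` times the closed
convex hull of the signed ramps (`integral_remainderMap_mem`). The remainder is thus a uniform limit
of averages of `m q` ramps (`exists_average`), and it is left to thin such an average to `m` terms.

Plain sampling would cost `m ^ (-1/2)`; the extra factor `m ^ (-1/d)` comes from stratification. The
parameters form a `d`-dimensional set (`d - 1` for the direction, one for the offset), so for `d ≥
2` the `m q` ramps split into `m` groups of `q` whose diameters `δ k` satisfy `∑ δ k ^ 2 = O(m ^ (1
- 2/d))`. One uniform choice from each group preserves the mean and deviates like a subgaussian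
variable of scale `√(∑ δ k ^ 2)`. Chaining over dyadic grids makes this uniform in `x` at the price
of `√(d + log m)` (`exists_selection`). Dividing by `m` gives the rate, even with outer weights
`±1`.

The grouping depends on `d`. For `d ≥ 3`, greedy extraction by pigeonhole suffices, since `∑ k ^
(-2/d)` has the right order. For `d = 2` that sum is harmonic and would cost a logarithm, so the
parameters are ordered along a Hilbert curve instead. For `d = 1` the sum is only bounded, which
yields `m ^ (-1)`: enough for weights `±1`, but not for the first claim, which follows from
piecewise linear interpolation with error `O(m ^ (-2))`. -/

/-- Parameters of a signed ramp `x ↦ ±(a·x - t)₊` with `‖a‖₁ = 1` and `t ∈ [0, 1]`. -/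
structure RidgeParam (d : ℕ) where
  sign : ℝ
  dir : EuclideanSpace ℝ (Fin d)
  offset : ℝ
  sign_eq : sign = -1 ∨ sign = 1
  dir_eq : l1Norm dir = 1
  offset_mem : offset ∈ Set.Icc (0 : ℝ) 1

/-- The signed ramp with the given parameters. -/
noncomputable def RidgeParam.ridge {d : ℕ} (θ : RidgeParam d) (x : EuclideanSpace ℝ (Fin d)) : ℝ :=
  θ.sign * relu (inner ℝ θ.dir x - θ.offset)

lemma abs_relu_sub_relu_le (a b : ℝ) : |relu a - relu b| ≤ |a - b| := by
  simpa [relu, max_comm] using abs_max_sub_max_le_abs a b 0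

lemma relu_nonneg (a : ℝ) : 0 ≤ relu a := le_max_left _ _

lemma l1Norm_nonneg {d : ℕ} (w : EuclideanSpace ℝ (Fin d)) : 0 ≤ l1Norm w :=
  Finset.sum_nonneg fun _ _ => abs_nonneg _

lemma inner_eq_sum {d : ℕ} (a x : EuclideanSpace ℝ (Fin d)) : inner ℝ a x = ∑ i, a i * x i := by
  simp [PiLp.inner_apply, mul_comm]

lemma abs_inner_le {d : ℕ} (a x : EuclideanSpace ℝ (Fin d)) {r : ℝ} (hx : ∀ i, |x i| ≤ r) :
    |(inner ℝ a x : ℝ)| ≤ l1Norm a * r := by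
  rw [inner_eq_sum, l1Norm, Finset.sum_mul]
  refine (Finset.abs_sum_le_sum_abs _ _).trans (Finset.sum_le_sum fun i _ => ?_)
  rw [abs_mul]
  exact mul_le_mul_of_nonneg_left (hx i) (abs_nonneg _)

lemma abs_apply_le_one {d : ℕ} {x : EuclideanSpace ℝ (Fin d)} (hx : x ∈ cube d) (i : Fin d) :
    |x i| ≤ 1 := abs_le.2 (hx i)

namespace RidgeParam

variable {d : ℕ}

lemma abs_sign (θ : RidgeParam d) : |θ.sign| = 1 := by
  rcases θ.sign_eq with h | h <;> simp [h]

lemma abs_ridge_sub_le (θ : RidgeParam d) (x y : EuclideanSpace ℝ (Fin d)) {r : ℝ}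
    (h : ∀ i, |x i - y i| ≤ r) : |θ.ridge x - θ.ridge y| ≤ r := by
  rw [ridge, ridge, ← mul_sub, abs_mul, θ.abs_sign, one_mul]
  refine (abs_relu_sub_relu_le _ _).trans ?_
  have := abs_inner_le θ.dir (x - y) (r := r) (by simpa using h)
  rw [θ.dir_eq, one_mul, inner_sub_right] at this
  simpa using this

lemma abs_ridge_sub_ridge_le {θ θ' : RidgeParam d} (hs : θ.sign = θ'.sign)
    {x : EuclideanSpace ℝ (Fin d)} (hx : x ∈ cube d) :
    |θ.ridge x - θ'.ridge x| ≤ l1Norm (θ.dir - θ'.dir) + |θ.offset - θ'.offset| := by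
  rw [ridge, ridge, hs, ← mul_sub, abs_mul, θ'.abs_sign, one_mul]
  refine (abs_relu_sub_relu_le _ _).trans ?_
  have := abs_inner_le (θ.dir - θ'.dir) x (r := 1) (abs_apply_le_one hx)
  rw [mul_one, inner_sub_left] at this
  calc _ = |((inner ℝ θ.dir x : ℝ) - inner ℝ θ'.dir x) - (θ.offset - θ'.offset)| := by
        congr 1; ring
    _ ≤ _ := (abs_sub _ _).trans (by gcongr)

lemma abs_ridge_le (θ : RidgeParam d) {x : EuclideanSpace ℝ (Fin d)} (hx : x ∈ cube d) :
    |θ.ridge x| ≤ 1 := by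
  rw [ridge, abs_mul, θ.abs_sign, one_mul, abs_of_nonneg (relu_nonneg _)]
  have := abs_inner_le θ.dir x (r := 1) (abs_apply_le_one hx)
  rw [θ.dir_eq, one_mul] at this
  have := (abs_le.1 this).2
  have := θ.offset_mem.1
  exact max_le zero_le_one (by linarith)

lemma abs_ridge_sub_ridge_le_two (θ θ' : RidgeParam d) {x : EuclideanSpace ℝ (Fin d)}
    (hx : x ∈ cube d) : |θ.ridge x - θ'.ridge x| ≤ 2 := by
  refine (abs_sub _ _).trans ?_
  have := θ.abs_ridge_le hx
  have := θ'.abs_ridge_le hx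
  linarith

end RidgeParam

/-! ### Maxima of sums of independent bounded variables -/

/-- Hoeffding's lemma for the uniform distribution on a finite set. -/
lemma sum_exp_mul_le {q : ℕ} (z : Fin q → ℝ) (hz : ∑ i, z i = 0) {c : ℝ} (hc : ∀ i, |z i| ≤ c)
    (l : ℝ) : ∑ i, Real.exp (l * z i) ≤ q * Real.exp (l ^ 2 * c ^ 2 / 2) := by
  -- By convexity `exp` lies below its chord over `[-l c, l c]`. The linear part of the chord sums
  -- to zero, which leaves `cosh`.
  have key : ∀ i, Real.exp (l * z i) ≤ Real.cosh (l * c) + z i * (Real.sinh (l * c) / c) := by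
    intro i
    rcases eq_or_ne c 0 with rfl | hc0
    · have : z i = 0 := abs_nonpos_iff.1 (hc i)
      simp [this]
    have hcpos : 0 < c := lt_of_le_of_ne ((abs_nonneg _).trans (hc i)) (Ne.symm hc0)
    obtain ⟨h1, h2⟩ := abs_le.1 (hc i)
    have ha : 0 ≤ (c + z i) / (2 * c) := div_nonneg (by linarith) (by linarith)
    have hb : 0 ≤ (c - z i) / (2 * c) := div_nonneg (by linarith) (by linarith)
    have hab : (c + z i) / (2 * c) + (c - z i) / (2 * c) = 1 := by field_simp; ring
    have hconv := convexOn_exp.2 (Set.mem_univ (l * c)) (Set.mem_univ (-(l * c))) ha hb hab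
    simp only [smul_eq_mul] at hconv
    have e1 : (c + z i) / (2 * c) * (l * c) + (c - z i) / (2 * c) * -(l * c) = l * z i := by
      field_simp; ring
    rw [e1] at hconv
    refine hconv.trans (le_of_eq ?_)
    rw [Real.cosh_eq, Real.sinh_eq]
    field_simp
    ring
  calc ∑ i, Real.exp (l * z i)
      ≤ ∑ i, (Real.cosh (l * c) + z i * (Real.sinh (l * c) / c)) := Finset.sum_le_sum fun i _ => key i
    _ = q * Real.cosh (l * c) := by
        rw [Finset.sum_add_distrib, ← Finset.sum_mul, hz]; simp
    _ ≤ q * Real.exp (l ^ 2 * c ^ 2 / 2) := by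
        gcongr
        refine (Real.cosh_le_exp_half_sq _).trans_eq ?_
        ring_nf

/-- Summing over all `ω` is, up to the factor `q ^ m`, an expectation over independent uniform
choices, so the exponential factors over the coordinates. -/
lemma sum_exp_sum_le {m q : ℕ} (Z : Fin m → Fin q → ℝ) (hmean : ∀ k, ∑ i, Z k i = 0)
    (c : Fin m → ℝ) (hZ : ∀ k i, |Z k i| ≤ c k) {σ : ℝ} (hσ : ∑ k, c k ^ 2 ≤ σ ^ 2) (l : ℝ) :
    ∑ ω : Fin m → Fin q, Real.exp (l * ∑ k, Z k (ω k)) ≤ q ^ m * Real.exp (l ^ 2 * σ ^ 2 / 2) := by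
  calc ∑ ω : Fin m → Fin q, Real.exp (l * ∑ k, Z k (ω k))
      = ∏ k, ∑ i, Real.exp (l * Z k i) := by
        rw [Finset.prod_univ_sum, Fintype.piFinset_univ]
        refine Finset.sum_congr rfl fun ω _ => ?_
        rw [Finset.mul_sum, Real.exp_sum]
    _ ≤ ∏ k : Fin m, ((q : ℝ) * Real.exp (l ^ 2 * c k ^ 2 / 2)) := by
        refine Finset.prod_le_prod (fun k _ => Finset.sum_nonneg fun i _ => (Real.exp_pos _).le)
          fun k _ => sum_exp_mul_le _ (hmean k) (hZ k) l
    _ = q ^ m * Real.exp (l ^ 2 * (∑ k, c k ^ 2) / 2) := by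
        rw [Finset.prod_mul_distrib, ← Real.exp_sum, Finset.mul_sum, Finset.sum_div]
        simp
    _ ≤ _ := by gcongr

/-- A random upper bound, with controlled average, for the maximum of a finite family of sums of
independent centred bounded variables. -/
lemma exists_maximal_bound {m q : ℕ} {T : Type*} (s : Finset T) (hs : s.Nonempty)
    (Z : T → Fin m → Fin q → ℝ) (hmean : ∀ τ ∈ s, ∀ k, ∑ i, Z τ k i = 0)
    (c : Fin m → ℝ) (hZ : ∀ τ ∈ s, ∀ k i, |Z τ k i| ≤ c k) {σ : ℝ} (hσ0 : 0 < σ)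
    (hσ : ∑ k, c k ^ 2 ≤ σ ^ 2) {L : ℝ} (hL0 : 0 < L) (hL : Real.log (2 * #s) ≤ L ^ 2) :
    ∃ Y : (Fin m → Fin q) → ℝ, (∀ ω, ∀ τ ∈ s, |∑ k, Z τ k (ω k)| ≤ Y ω) ∧
      ∑ ω, Y ω ≤ q ^ m * (3 / 2 * σ * L) := by
  -- This `l` makes `l ^ 2 * σ ^ 2 = L ^ 2`; then `log A / l ≤ (L ^ 2 + L ^ 2 / 2) / l = 3 / 2 * σ *
  -- L`.
  set l : ℝ := L / σ with hl
  have hlpos : 0 < l := by positivity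
  have hcard : (0 : ℝ) < #s := by exact_mod_cast hs.card_pos
  set A : ℝ := 2 * #s * Real.exp (l ^ 2 * σ ^ 2 / 2) with hA
  have hApos : 0 < A := by positivity
  set X : T → (Fin m → Fin q) → ℝ := fun τ ω => ∑ k, Z τ k (ω k) with hX
  -- The logarithm of the exponential sum is replaced by its tangent at `A`, through `log t ≤ t -
  -- 1`. The bound is then affine in the exponentials and can be averaged termwise. `A` dominates
  -- the mean of the sum, so the `-1` is compensated.
  refine ⟨fun ω => l⁻¹ * (Real.log A - 1 +
    A⁻¹ * ∑ τ ∈ s, (Real.exp (l * X τ ω) + Real.exp (-l * X τ ω))), ?_, ?_⟩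
  · intro ω τ hτ
    change |X τ ω| ≤ l⁻¹ * (Real.log A - 1 +
      A⁻¹ * ∑ τ ∈ s, (Real.exp (l * X τ ω) + Real.exp (-l * X τ ω)))
    rw [inv_mul_eq_div, le_div_iff₀ hlpos]
    have h1 : Real.exp (l * |X τ ω|) ≤
        ∑ τ ∈ s, (Real.exp (l * X τ ω) + Real.exp (-l * X τ ω)) := by
      refine le_trans ?_ (Finset.single_le_sum (f := fun τ => Real.exp (l * X τ ω) +
        Real.exp (-l * X τ ω)) (fun i _ => by positivity) hτ)
      rcases abs_cases (X τ ω) with ⟨h, _⟩ | ⟨h, _⟩ <;> rw [h]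
      · linarith [Real.exp_pos (-l * X τ ω)]
      · rw [mul_neg, ← neg_mul]; linarith [Real.exp_pos (l * X τ ω)]
    have h2 := Real.log_le_sub_one_of_pos (x := A⁻¹ * Real.exp (l * |X τ ω|)) (by positivity)
    rw [Real.log_mul (by positivity) (by positivity), Real.log_inv, Real.log_exp] at h2
    have h3 := mul_le_mul_of_nonneg_left h1 (inv_nonneg.2 hApos.le)
    linarith
  · have h1 : ∑ ω, ∑ τ ∈ s, (Real.exp (l * X τ ω) + Real.exp (-l * X τ ω)) ≤ q ^ m * A := by
      rw [Finset.sum_comm]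
      calc _ ≤ ∑ τ ∈ s, (2 * ((q : ℝ) ^ m * Real.exp (l ^ 2 * σ ^ 2 / 2))) := by
            refine Finset.sum_le_sum fun τ hτ => ?_
            rw [Finset.sum_add_distrib, two_mul]
            refine add_le_add (sum_exp_sum_le _ (hmean τ hτ) c (hZ τ hτ) hσ l) ?_
            have := sum_exp_sum_le _ (hmean τ hτ) c (hZ τ hτ) hσ (-l)
            rwa [neg_sq] at this
        _ = _ := by rw [Finset.sum_const, nsmul_eq_mul, hA]; ring
    rw [← Finset.mul_sum, Finset.sum_add_distrib, ← Finset.mul_sum, Finset.sum_const,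
      Finset.card_univ, nsmul_eq_mul]
    have hc : (Fintype.card (Fin m → Fin q) : ℝ) = q ^ m := by simp
    rw [hc]
    have h2 : A⁻¹ * ∑ ω, ∑ τ ∈ s, (Real.exp (l * X τ ω) + Real.exp (-l * X τ ω)) ≤ q ^ m := by
      rw [inv_mul_le_iff₀ hApos, mul_comm]; exact h1
    have h3 : Real.log A ≤ 3 / 2 * L ^ 2 := by
      rw [hA, Real.log_mul (by positivity) (by positivity), Real.log_exp]
      have : l ^ 2 * σ ^ 2 = L ^ 2 := by rw [hl]; field_simp
      rw [this]; linarith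
    calc _ ≤ l⁻¹ * ((q : ℝ) ^ m * (Real.log A - 1) + q ^ m) := by gcongr
      _ = (q : ℝ) ^ m * (l⁻¹ * Real.log A) := by ring
      _ ≤ (q : ℝ) ^ m * (l⁻¹ * (3 / 2 * L ^ 2)) := by gcongr
      _ = _ := by rw [hl]; field_simp

end RidgeApprox

namespace RidgeApprox

open Finset

/-! ### Dyadic grids of the cube -/

/-- The indices of the points of mesh `1 / N` of the cube. -/
noncomputable def gridIndex (d N : ℕ) : Finset (Fin d → ℤ) :=
  Fintype.piFinset fun _ => Finset.Icc (-(N : ℤ)) N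

/-- The point of mesh `1 / N` with the given index. -/
noncomputable def gridPoint {d : ℕ} (N : ℕ) (p : Fin d → ℤ) : EuclideanSpace ℝ (Fin d) :=
  WithLp.toLp 2 fun i => (p i : ℝ) / N

/-- The index of the grid point obtained by rounding down the coordinates. -/
noncomputable def gridRound {d : ℕ} (N : ℕ) (x : EuclideanSpace ℝ (Fin d)) : Fin d → ℤ :=
  fun i => ⌊x i * N⌋

lemma card_gridIndex (d N : ℕ) : #(gridIndex d N) = (2 * N + 1) ^ d := by
  rw [gridIndex, Fintype.card_piFinset]
  simp only [Int.card_Icc, Finset.prod_const, Finset.card_univ, Fintype.card_fin]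
  congr 1
  omega

lemma gridPoint_mem_cube {d N : ℕ} (hN : 0 < N) {p : Fin d → ℤ} (hp : p ∈ gridIndex d N) :
    gridPoint N p ∈ cube d := by
  intro i
  have h := Fintype.mem_piFinset.1 hp i
  rw [Finset.mem_Icc] at h
  have hN' : (0 : ℝ) < N := by exact_mod_cast hN
  have h1 : (-(N : ℝ)) ≤ p i := by exact_mod_cast h.1
  have h2 : (p i : ℝ) ≤ N := by exact_mod_cast h.2
  simp only [gridPoint]
  exact ⟨by rw [le_div_iff₀ hN']; linarith, by rw [div_le_iff₀ hN']; linarith⟩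

lemma gridRound_mem {d N : ℕ} {x : EuclideanSpace ℝ (Fin d)} (hx : x ∈ cube d) :
    gridRound N x ∈ gridIndex d N := by
  refine Fintype.mem_piFinset.2 fun i => Finset.mem_Icc.2 ⟨?_, ?_⟩
  · refine Int.le_floor.2 ?_
    have := mul_le_mul_of_nonneg_right (hx i).1 (Nat.cast_nonneg (α := ℝ) N)
    push_cast; linarith
  · have := mul_le_mul_of_nonneg_right (hx i).2 (Nat.cast_nonneg (α := ℝ) N)
    have h2 := (Int.floor_le (x i * N)).trans this
    rw [one_mul] at h2
    exact Int.cast_le.1 (h2.trans_eq (Int.cast_natCast N).symm)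

lemma abs_sub_gridPoint_gridRound_le {d N : ℕ} (hN : 0 < N) (x : EuclideanSpace ℝ (Fin d))
    (i : Fin d) : |x i - gridPoint N (gridRound N x) i| ≤ 1 / N := by
  have hN' : (0 : ℝ) < N := by exact_mod_cast hN
  have h1 := Int.floor_le (x i * N)
  have h2 := Int.lt_floor_add_one (x i * N)
  have e : x i - gridPoint N (gridRound N x) i = (x i * N - ⌊x i * N⌋) / N := by
    simp only [gridPoint, gridRound]; field_simp
  rw [e, abs_div, abs_of_pos hN', abs_of_nonneg (by linarith)]
  gcongr; linarith

/-- The index, at mesh `1 / N`, of the point below a point of mesh `1 / (2 N)`. -/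
def gridParent {d : ℕ} (p : Fin d → ℤ) : Fin d → ℤ := fun i => p i / 2

/-- Rounding down is compatible with coarsening, so an increment of the chain of `x` depends only on
its finer index. The union bound at a level then runs over one grid, not over pairs. -/
lemma gridParent_gridRound {d : ℕ} (N : ℕ) (x : EuclideanSpace ℝ (Fin d)) :
    gridParent (gridRound (N * 2) x) = gridRound N x := by
  funext i
  simp only [gridParent, gridRound]
  have h1 : 2 * ⌊x i * N⌋ ≤ ⌊x i * ((N * 2 : ℕ) : ℝ)⌋ := by
    refine Int.le_floor.2 ?_
    have := Int.floor_le (x i * N)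
    push_cast; linarith
  have h2 : ⌊x i * ((N * 2 : ℕ) : ℝ)⌋ < 2 * ⌊x i * N⌋ + 2 := by
    refine Int.floor_lt.2 ?_
    have := Int.lt_floor_add_one (x i * N)
    push_cast; linarith
  omega

lemma abs_gridPoint_sub_gridParent_le {d N : ℕ} (hN : 0 < N) (p : Fin d → ℤ) (i : Fin d) :
    |gridPoint (N * 2) p i - gridPoint N (gridParent p) i| ≤ 1 / (2 * N) := by
  have hN' : (0 : ℝ) < N := by exact_mod_cast hN
  have e : gridPoint (N * 2) p i - gridPoint N (gridParent p) i =
      ((p i - 2 * (p i / 2) : ℤ) : ℝ) / (2 * N) := by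
    simp only [gridPoint, gridParent]; push_cast; field_simp
  rw [e, abs_div, abs_of_pos (by positivity : (0 : ℝ) < 2 * N)]
  gcongr
  rw [← Int.cast_abs]
  have h : |p i - 2 * (p i / 2)| ≤ 1 := abs_le.2 ⟨by omega, by omega⟩
  exact (Int.cast_le (R := ℝ)).2 h |>.trans_eq Int.cast_one

/-! ### Chaining -/

/-- The deviation of a ridge function from the mean of its group. -/
noncomputable def groupDev {d q : ℕ} (θ : Fin q → RidgeParam d) (i : Fin q)
    (x : EuclideanSpace ℝ (Fin d)) : ℝ :=
  (θ i).ridge x - (q : ℝ)⁻¹ * ∑ j, (θ j).ridge x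

/-- In this form a deviation is an average of differences inside the group, hence bounded by the
diameter. -/
lemma groupDev_eq {d q : ℕ} (hq : 0 < q) (θ : Fin q → RidgeParam d) (i : Fin q)
    (x : EuclideanSpace ℝ (Fin d)) :
    groupDev θ i x = (q : ℝ)⁻¹ * ∑ j, ((θ i).ridge x - (θ j).ridge x) := by
  have : (q : ℝ) ≠ 0 := by exact_mod_cast hq.ne'
  rw [groupDev, Finset.sum_sub_distrib]
  simp; field_simp

lemma sum_groupDev {d q : ℕ} (hq : 0 < q) (θ : Fin q → RidgeParam d)
    (x : EuclideanSpace ℝ (Fin d)) : ∑ i, groupDev θ i x = 0 := by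
  have : (q : ℝ) ≠ 0 := by exact_mod_cast hq.ne'
  simp only [groupDev, Finset.sum_sub_distrib]
  simp; field_simp; ring

lemma abs_groupDev_le {d q : ℕ} (hq : 0 < q) {θ : Fin q → RidgeParam d} {δ : ℝ}
    {x : EuclideanSpace ℝ (Fin d)} (h : ∀ i j, |(θ i).ridge x - (θ j).ridge x| ≤ δ) (i : Fin q) :
    |groupDev θ i x| ≤ δ := by
  have hq' : (0 : ℝ) < q := by exact_mod_cast hq
  rw [groupDev_eq hq, abs_mul, abs_of_pos (inv_pos.2 hq'), inv_mul_le_iff₀ hq']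
  refine (Finset.abs_sum_le_sum_abs _ _).trans ((Finset.sum_le_sum fun j _ => h i j).trans ?_)
  simp

lemma abs_groupDev_sub_le {d q : ℕ} (hq : 0 < q) (θ : Fin q → RidgeParam d)
    {x y : EuclideanSpace ℝ (Fin d)} {r : ℝ} (h : ∀ i, |x i - y i| ≤ r) (i : Fin q) :
    |groupDev θ i x - groupDev θ i y| ≤ 2 * r := by
  have hq' : (0 : ℝ) < q := by exact_mod_cast hq
  have e : groupDev θ i x - groupDev θ i y = ((θ i).ridge x - (θ i).ridge y) -
      (q : ℝ)⁻¹ * ∑ j, ((θ j).ridge x - (θ j).ridge y) := by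
    rw [groupDev, groupDev, Finset.sum_sub_distrib]; ring
  have h2 : |(q : ℝ)⁻¹ * ∑ j, ((θ j).ridge x - (θ j).ridge y)| ≤ r := by
    rw [abs_mul, abs_of_pos (inv_pos.2 hq'), inv_mul_le_iff₀ hq']
    refine (Finset.abs_sum_le_sum_abs _ _).trans
      ((Finset.sum_le_sum fun j _ => (θ j).abs_ridge_sub_le x y h).trans ?_)
    simp
  rw [e]
  refine (abs_sub _ _).trans ?_
  linarith [(θ i).abs_ridge_sub_le x y h]

/-- The chaining series: `j + 2` comes from the grid entropy and `2 ^ (-j)` from the mesh. Only the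
bound 6 is used. -/
lemma sum_range_add_two_div_two_pow (J : ℕ) :
    ∑ j ∈ range J, ((j : ℝ) + 2) / 2 ^ j = 6 - (2 * J + 6) / 2 ^ J := by
  induction J with
  | zero => norm_num
  | succ J ih =>
    rw [Finset.sum_range_succ, ih, pow_succ]
    push_cast
    field_simp
    ring

/-- With initial mesh about `m ^ (-1/d)`, the `d`-th power of the number of nodes per axis
contributes only `log m + O(d (j + 1))`. The square of `j + 1` on the right is generous and gives
`L` a simple form. -/
lemma log_card_gridIndex_le {d m : ℕ} (hd : 1 ≤ d) (hm : 1 ≤ m) (j : ℕ) :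
    Real.log (2 * #(gridIndex d (⌈(m : ℝ) ^ (1 / (d : ℝ))⌉₊ * 2 ^ j))) ≤
      (2 * √((d : ℝ) + Real.log m) * (j + 1)) ^ 2 := by
  set n := ⌈(m : ℝ) ^ (1 / (d : ℝ))⌉₊ with hn
  have hd' : (1 : ℝ) ≤ d := by exact_mod_cast hd
  have hm' : (1 : ℝ) ≤ m := by exact_mod_cast hm
  have hlogm : 0 ≤ Real.log m := Real.log_nonneg hm'
  have hr1 : 1 ≤ (m : ℝ) ^ (1 / (d : ℝ)) := Real.one_le_rpow hm' (by positivity)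
  have hn2 : (n : ℝ) ≤ 2 * (m : ℝ) ^ (1 / (d : ℝ)) := by
    have := Nat.ceil_lt_add_one (zero_le_one.trans hr1)
    rw [← hn] at this; linarith
  have hn1 : (1 : ℝ) ≤ n := hr1.trans (Nat.le_ceil _)
  have h2j : (1 : ℝ) ≤ 2 ^ j := one_le_pow₀ (by norm_num)
  have hN : 1 ≤ (n : ℝ) * 2 ^ j := one_le_mul_of_one_le_of_one_le hn1 h2j
  rw [card_gridIndex]
  push_cast
  rw [Real.log_mul (by norm_num) (by positivity), Real.log_pow]
  have h1 : Real.log (2 * ((n : ℝ) * 2 ^ j) + 1) ≤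
      3 * Real.log 2 + Real.log m / d + j * Real.log 2 := by
    calc Real.log (2 * ((n : ℝ) * 2 ^ j) + 1)
        ≤ Real.log (2 ^ 3 * (m : ℝ) ^ (1 / (d : ℝ)) * 2 ^ j) := by
          refine Real.log_le_log (by positivity) ?_
          have := mul_le_mul_of_nonneg_right hn2 (by positivity : (0 : ℝ) ≤ 2 ^ j)
          nlinarith
      _ = _ := by
          rw [Real.log_mul (by positivity) (by positivity),
            Real.log_mul (by positivity) (by positivity), Real.log_pow, Real.log_pow,
            Real.log_rpow (by positivity)]
          push_cast; ring
  have hl2 := Real.log_two_lt_d9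
  have hl2' := Real.log_pos (one_lt_two (α := ℝ))
  have h2 := mul_le_mul_of_nonneg_left h1 (zero_le_one.trans hd')
  have e : (d : ℝ) * (3 * Real.log 2 + Real.log m / d + j * Real.log 2) =
      (3 + j) * d * Real.log 2 + Real.log m := by field_simp; ring
  rw [mul_pow, mul_pow, Real.sq_sqrt (by positivity)]
  have hj : (0 : ℝ) ≤ j := Nat.cast_nonneg j
  have h3 : (3 + j) * d * Real.log 2 ≤ (3 + j) * d * 0.7 := by gcongr; linarith
  nlinarith [mul_nonneg hj hlogm, mul_nonneg hj (zero_le_one.trans hd'),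
    mul_nonneg (sq_nonneg (j : ℝ)) hlogm, mul_nonneg (sq_nonneg (j : ℝ)) (zero_le_one.trans hd')]

/-- Stratified selection: from `m` groups of ridge functions one can select one member each so
that the sum of the selected functions is uniformly close to the sum of the group means. -/
theorem exists_selection {d m q : ℕ} (hd : 1 ≤ d) (hm : 1 ≤ m) (hq : 0 < q)
    (θ : Fin m → Fin q → RidgeParam d) (δ : Fin m → ℝ)
    (hδ : ∀ k i j, ∀ x ∈ cube d, |(θ k i).ridge x - (θ k j).ridge x| ≤ δ k)
    {σ : ℝ} (hσ : ∑ k, δ k ^ 2 ≤ σ ^ 2) (hσm : √m * (m : ℝ) ^ (-(1 / (d : ℝ))) ≤ σ) :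
    ∃ ω : Fin m → Fin q, ∀ x ∈ cube d,
      |∑ k, groupDev (θ k) (ω k) x| ≤ 23 * √((d : ℝ) + Real.log m) * σ := by
  have hd' : (1 : ℝ) ≤ d := by exact_mod_cast hd
  have hm' : (1 : ℝ) ≤ m := by exact_mod_cast hm
  have hlogm : 0 ≤ Real.log m := Real.log_nonneg hm'
  have hq' : (0 : ℝ) < q := by exact_mod_cast hq
  set S := √((d : ℝ) + Real.log m) with hS
  have hS1 : 1 ≤ S := Real.one_le_sqrt.2 (by linarith)
  set n := ⌈(m : ℝ) ^ (1 / (d : ℝ))⌉₊ with hn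
  have hr1 : 1 ≤ (m : ℝ) ^ (1 / (d : ℝ)) := Real.one_le_rpow hm' (by positivity)
  have hn1 : (m : ℝ) ^ (1 / (d : ℝ)) ≤ n := Nat.le_ceil _
  have hnpos : (0 : ℝ) < n := by linarith
  have hnpos' : 0 < n := by exact_mod_cast hnpos
  have hσ0 : 0 < σ := lt_of_lt_of_le (by positivity) hσm
  have hσn : √m / n ≤ σ := by
    refine le_trans ?_ hσm
    rw [Real.rpow_neg (by positivity), div_eq_mul_inv]
    gcongr
  have hsqm : √(m : ℝ) ^ 2 = m := Real.sq_sqrt (by positivity)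
  have hNpos : ∀ j, 0 < n * 2 ^ j := fun j => by positivity
  -- the coarsest level
  obtain ⟨Y₀, hY₀, hY₀s⟩ := exists_maximal_bound (gridIndex d (n * 2 ^ 0))
    (Finset.card_pos.1 (by rw [card_gridIndex]; positivity))
    (fun p k i => groupDev (θ k) i (gridPoint (n * 2 ^ 0) p))
    (fun p _ k => sum_groupDev hq _ _) δ
    (fun p hp k i => abs_groupDev_le hq
      (fun i j => hδ k i j _ (gridPoint_mem_cube (hNpos 0) hp)) i)
    hσ0 hσ (L := 2 * S * ((0 : ℕ) + 1)) (by positivity) (log_card_gridIndex_le hd hm 0)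
  -- the increments
  have hlev : ∀ j : ℕ, ∃ Y : (Fin m → Fin q) → ℝ,
      (∀ ω, ∀ p ∈ gridIndex d (n * 2 ^ (j + 1)),
        |∑ k, (groupDev (θ k) (ω k) (gridPoint (n * 2 ^ (j + 1)) p) -
          groupDev (θ k) (ω k) (gridPoint (n * 2 ^ j) (gridParent p)))| ≤ Y ω) ∧
      ∑ ω, Y ω ≤ q ^ m * (3 / 2 * (σ / 2 ^ j) * (2 * S * ((j + 1 : ℕ) + 1))) := by
    intro j
    have hN : (0 : ℝ) < ((n * 2 ^ j : ℕ) : ℝ) := by exact_mod_cast hNpos j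
    refine exists_maximal_bound (gridIndex d (n * 2 ^ (j + 1)))
      (Finset.card_pos.1 (by rw [card_gridIndex]; positivity))
      (fun p k i => groupDev (θ k) i (gridPoint (n * 2 ^ (j + 1)) p) -
          groupDev (θ k) i (gridPoint (n * 2 ^ j) (gridParent p)))
      (fun p _ k => by rw [Finset.sum_sub_distrib, sum_groupDev hq, sum_groupDev hq, sub_zero])
      (fun _ => 1 / ((n * 2 ^ j : ℕ) : ℝ)) ?_ (by positivity) ?_ (by positivity)
      (log_card_gridIndex_le hd hm (j + 1))
    · intro p _ k i
      refine (abs_groupDev_sub_le hq (θ k) (r := 1 / (2 * ((n * 2 ^ j : ℕ) : ℝ))) ?_ i).trans_eq ?_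
      · intro i
        rw [pow_succ, ← mul_assoc]
        exact abs_gridPoint_sub_gridParent_le (hNpos j) p i
      · field_simp
    -- The increments use only the Lipschitz bound, the same for all groups; `hσn` turns `m / n ^ 2`
    -- into `σ ^ 2`. The diameters `δ` enter at the coarsest level alone.
    · rw [Finset.sum_const, Finset.card_univ, Fintype.card_fin, nsmul_eq_mul]
      calc (m : ℝ) * (1 / ((n * 2 ^ j : ℕ) : ℝ)) ^ 2 = (√m / n / 2 ^ j) ^ 2 := by
            rw [div_pow, div_pow, div_pow, hsqm]; push_cast; field_simp
        _ ≤ (σ / 2 ^ j) ^ 2 := by gcongr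
  choose Y hY hYs using hlev
  -- The coarsest level contributes `3 S σ` and the increments at most `3 * 6 = 18` times `S σ`.
  -- Bounding the sum of all levels on average produces a single `ω` that serves them all.
  have htot : ∑ ω, (Y₀ ω + ∑ j ∈ range m, Y j ω) ≤
      ∑ _ω : Fin m → Fin q, 21 * S * σ := by
    rw [Finset.sum_add_distrib, Finset.sum_comm, Finset.sum_const, Finset.card_univ]
    have hc : (Fintype.card (Fin m → Fin q) : ℝ) = q ^ m := by simp
    rw [nsmul_eq_mul, hc]
    have h1 : ∑ j ∈ range m, ∑ ω, Y j ω ≤ q ^ m * (18 * S * σ) := by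
      calc ∑ j ∈ range m, ∑ ω, Y j ω
          ≤ ∑ j ∈ range m, (q : ℝ) ^ m * (3 / 2 * (σ / 2 ^ j) * (2 * S * ((j + 1 : ℕ) + 1))) :=
            Finset.sum_le_sum fun j _ => hYs j
        _ = (q : ℝ) ^ m * (3 * S * σ * ∑ j ∈ range m, ((j : ℝ) + 2) / 2 ^ j) := by
            rw [Finset.mul_sum, Finset.mul_sum]
            refine Finset.sum_congr rfl fun j _ => ?_
            push_cast; ring
        _ ≤ (q : ℝ) ^ m * (3 * S * σ * 6) := by
            gcongr
            rw [sum_range_add_two_div_two_pow]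
            have : (0 : ℝ) ≤ (2 * m + 6) / 2 ^ m := by positivity
            linarith
        _ = _ := by ring
    calc _ ≤ (q : ℝ) ^ m * (3 / 2 * σ * (2 * S * ((0 : ℕ) + 1))) + q ^ m * (18 * S * σ) :=
          add_le_add hY₀s h1
      _ = _ := by push_cast; ring
  have : Nonempty (Fin q) := ⟨⟨0, hq⟩⟩
  obtain ⟨ω, -, hω⟩ := Finset.exists_le_of_sum_le Finset.univ_nonempty htot
  refine ⟨ω, fun x hx => ?_⟩
  set X : EuclideanSpace ℝ (Fin d) → ℝ := fun y => ∑ k, groupDev (θ k) (ω k) y with hX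
  set P : ℕ → EuclideanSpace ℝ (Fin d) := fun j =>
    gridPoint (n * 2 ^ j) (gridRound (n * 2 ^ j) x) with hP
  have h0 : |X (P 0)| ≤ Y₀ ω := hY₀ ω _ (gridRound_mem hx)
  have hinc : ∀ j, |X (P (j + 1)) - X (P j)| ≤ Y j ω := by
    intro j
    have := hY j ω _ (gridRound_mem (N := n * 2 ^ (j + 1)) hx)
    rw [Finset.sum_sub_distrib] at this
    have e : gridParent (gridRound (n * 2 ^ (j + 1)) x) = gridRound (n * 2 ^ j) x := by
      rw [pow_succ, ← mul_assoc, gridParent_gridRound]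
    rw [e] at this
    exact this
  -- After `m` levels the mesh is so fine that the trivial Lipschitz estimate suffices, because `√m
  -- ≤ 2 ^ m`. With `S ≥ 1` the total is `21 + 2 = 23`.
  have hend : |X x - X (P m)| ≤ 2 * σ := by
    rw [hX]
    simp only
    rw [← Finset.sum_sub_distrib]
    refine (Finset.abs_sum_le_sum_abs _ _).trans ((Finset.sum_le_sum fun k _ =>
      abs_groupDev_sub_le hq (θ k) (abs_sub_gridPoint_gridRound_le (hNpos m) x) (ω k)).trans ?_)
    rw [Finset.sum_const, Finset.card_univ, Fintype.card_fin, nsmul_eq_mul]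
    have h2m : √(m : ℝ) ≤ 2 ^ m := by
      have h1 : (m : ℝ) ≤ 2 ^ m := by exact_mod_cast (Nat.lt_two_pow_self).le
      have h2 : √(m : ℝ) ≤ m := by
        nlinarith [Real.sqrt_nonneg (m : ℝ), Real.one_le_sqrt.2 hm']
      exact h2.trans h1
    calc (m : ℝ) * (2 * (1 / ((n * 2 ^ m : ℕ) : ℝ))) = 2 * (√m / n) * (√m / 2 ^ m) := by
          push_cast; field_simp; rw [hsqm]
      _ ≤ 2 * (√m / n) * 1 := by
          gcongr
          exact (div_le_one (by positivity)).2 h2m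
      _ ≤ _ := by linarith
  have htel : X x = X (P 0) + ∑ j ∈ range m, (X (P (j + 1)) - X (P j)) + (X x - X (P m)) := by
    rw [Finset.sum_range_sub (fun j => X (P j))]; ring
  have hsum : |∑ j ∈ range m, (X (P (j + 1)) - X (P j))| ≤ ∑ j ∈ range m, Y j ω :=
    (Finset.abs_sum_le_sum_abs _ _).trans (Finset.sum_le_sum fun j _ => hinc j)
  change |X x| ≤ _
  rw [htel]
  refine (abs_add_three _ _ _).trans ?_
  nlinarith [mul_le_mul_of_nonneg_right hS1 hσ0.le]

end RidgeApprox

namespace RidgeApprox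

open Finset

/-! ### Counting lattice points of `ℓ¹` balls -/

/-- One factor of the generating function of the `ℓ¹` norm on a box of integer vectors. Splitting by
sign counts `0` twice, which is harmless for an upper bound. -/
lemma sum_pow_natAbs_le {x : ℝ} (hx0 : 0 ≤ x) (hx1 : x < 1) (R : ℕ) :
    ∑ a ∈ Finset.Icc (-(R : ℤ)) R, x ^ a.natAbs ≤ 2 * (1 - x)⁻¹ := by
  have hgeom : ∑ i ∈ range (R + 1), x ^ i ≤ (1 - x)⁻¹ := by
    rw [← tsum_geometric_of_lt_one hx0 hx1]
    exact (summable_geometric_of_lt_one hx0 hx1).sum_le_tsum _ fun i _ => pow_nonneg hx0 i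
  set s := (range (R + 1)).image (fun i : ℕ => (i : ℤ)) with hs
  set t := (range (R + 1)).image (fun i : ℕ => -(i : ℤ)) with ht
  have hsub : Finset.Icc (-(R : ℤ)) R ⊆ s ∪ t := by
    intro a ha
    rw [Finset.mem_Icc] at ha
    simp only [hs, ht, Finset.mem_union, Finset.mem_image, Finset.mem_range]
    rcases le_total 0 a with h | h
    · exact Or.inl ⟨a.natAbs, by omega, by omega⟩
    · exact Or.inr ⟨a.natAbs, by omega, by omega⟩
  have hnn : ∀ a : ℤ, 0 ≤ x ^ a.natAbs := fun a => pow_nonneg hx0 _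
  have h1 : ∑ a ∈ s, x ^ a.natAbs = ∑ i ∈ range (R + 1), x ^ i := by
    rw [hs, Finset.sum_image (fun a _ b _ h => by simpa using h)]
    simp
  have h2 : ∑ a ∈ t, x ^ a.natAbs = ∑ i ∈ range (R + 1), x ^ i := by
    rw [ht, Finset.sum_image (fun a _ b _ h => by simpa using h)]
    simp
  have h3 := Finset.sum_union_inter (s₁ := s) (s₂ := t) (f := fun a : ℤ => x ^ a.natAbs)
  have h4 : 0 ≤ ∑ a ∈ s ∩ t, x ^ a.natAbs := Finset.sum_nonneg fun a _ => hnn a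
  have h5 := Finset.sum_le_sum_of_subset_of_nonneg hsub (f := fun a : ℤ => x ^ a.natAbs)
    (fun a _ _ => hnn a)
  linarith

/-- The integer vectors of `ℓ¹` norm at most `R`. -/
noncomputable def latticeBall (d R : ℕ) : Finset (Fin d → ℤ) :=
  (Fintype.piFinset fun _ => Finset.Icc (-(R : ℤ)) R).filter fun p => ∑ i, (p i).natAbs ≤ R

lemma mem_latticeBall {d R : ℕ} {p : Fin d → ℤ} :
    p ∈ latticeBall d R ↔ ∑ i, (p i).natAbs ≤ R := by
  rw [latticeBall, Finset.mem_filter, and_iff_right_iff_imp]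
  intro h
  refine Fintype.mem_piFinset.2 fun i => Finset.mem_Icc.2 ?_
  have := Finset.single_le_sum (f := fun i => (p i).natAbs) (fun _ _ => Nat.zero_le _)
    (Finset.mem_univ i)
  omega

/-- Each lattice point has weight at least `x ^ R` in the generating function. With `x = n / (n +
1)` every factor is at most `2 (n + 1) ≤ 4 n`, and `x ^ (-R) ≤ exp (3 d) ≤ 27 ^ d`. Counting in the
enclosing cube would leave a factor of order `d ^ d`, fatal for a universal constant. -/
lemma card_latticeBall_le {d n : ℕ} (hn : 1 ≤ n) :
    (#(latticeBall d (3 * d * n)) : ℝ) ≤ (108 * n) ^ d := by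
  have hn' : (1 : ℝ) ≤ n := by exact_mod_cast hn
  set R := 3 * d * n with hR
  set x : ℝ := n / (n + 1) with hx
  have hx0 : 0 < x := by positivity
  have hx1 : x < 1 := by rw [hx, div_lt_one (by positivity)]; linarith
  have hx2 : (1 - x)⁻¹ = n + 1 := by
    rw [hx]; field_simp; ring
  have h1 : #(latticeBall d R) * x ^ R ≤ (2 * ((n : ℝ) + 1)) ^ d := by
    calc (#(latticeBall d R) : ℝ) * x ^ R
        ≤ ∑ p ∈ latticeBall d R, x ^ ∑ i, (p i).natAbs := by
          rw [← nsmul_eq_mul]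
          refine Finset.card_nsmul_le_sum _ _ _ fun p hp => ?_
          exact pow_le_pow_of_le_one hx0.le hx1.le (mem_latticeBall.1 hp)
      _ ≤ ∑ p ∈ Fintype.piFinset fun _ : Fin d => Finset.Icc (-(R : ℤ)) R,
            x ^ ∑ i, (p i).natAbs :=
          Finset.sum_le_sum_of_subset_of_nonneg (Finset.filter_subset _ _)
            fun _ _ _ => pow_nonneg hx0.le _
      _ = (∑ a ∈ Finset.Icc (-(R : ℤ)) R, x ^ a.natAbs) ^ d := by
          simp_rw [← Finset.prod_pow_eq_pow_sum]
          have := Finset.prod_univ_sum (fun _ : Fin d => Finset.Icc (-(R : ℤ)) R)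
            (fun _ a => x ^ a.natAbs)
          rw [← this]
          simp
      _ ≤ (2 * ((n : ℝ) + 1)) ^ d := by
          rw [← hx2]
          exact pow_le_pow_left₀ (Finset.sum_nonneg fun a _ => pow_nonneg hx0.le _)
            (sum_pow_natAbs_le hx0.le hx1 R) d
  have h2 : (x ^ R)⁻¹ ≤ 27 ^ d := by
    have e1 : x⁻¹ = 1 + 1 / n := by rw [hx]; field_simp
    have e2 : x⁻¹ ^ n ≤ 3 := by
      rw [e1]
      calc (1 + 1 / (n : ℝ)) ^ n ≤ Real.exp (1 / n) ^ n := by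
            gcongr
            rw [add_comm]
            exact Real.add_one_le_exp _
        _ = Real.exp 1 := by
            rw [← Real.exp_nat_mul]; congr 1; field_simp
        _ ≤ 3 := by linarith [Real.exp_one_lt_d9]
    rw [← inv_pow, hR, mul_comm (3 * d) n, pow_mul]
    calc (x⁻¹ ^ n) ^ (3 * d) ≤ 3 ^ (3 * d) := by gcongr
      _ = 27 ^ d := by rw [pow_mul]; norm_num
  calc (#(latticeBall d R) : ℝ) = #(latticeBall d R) * x ^ R * (x ^ R)⁻¹ := by
        field_simp
    _ ≤ (2 * ((n : ℝ) + 1)) ^ d * 27 ^ d := by gcongr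
    _ ≤ (108 * n) ^ d := by
        rw [← mul_pow]
        exact pow_le_pow_left₀ (by positivity) (by linarith) d

/-! ### Small cells in the parameter space -/

/-- On the `ℓ¹` sphere one coordinate is determined by its sign and the others. This frees slot `i₀`
of `cellCode` for the offset, so that `d` integers suffice rather than `d + 1`. -/
lemma abs_sub_abs_le_sum {d : ℕ} {a b : EuclideanSpace ℝ (Fin d)} (ha : l1Norm a = 1)
    (hb : l1Norm b = 1) (i₀ : Fin d) (hs : 0 ≤ a i₀ ↔ 0 ≤ b i₀) :
    |a i₀ - b i₀| ≤ ∑ i ∈ univ.erase i₀, |a i - b i| := by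
  rw [l1Norm, ← Finset.add_sum_erase _ _ (Finset.mem_univ i₀)] at ha hb
  have h1 : |a i₀ - b i₀| = |(|a i₀| - |b i₀|)| := by
    rcases le_or_gt 0 (a i₀) with h | h
    · rw [abs_of_nonneg h, abs_of_nonneg (hs.1 h)]
    · have h' : b i₀ < 0 := not_le.1 fun hb => absurd (hs.2 hb) (not_le.2 h)
      rw [abs_of_neg h, abs_of_neg h', neg_sub_neg, abs_sub_comm]
  have h2 : |a i₀| - |b i₀| = ∑ i ∈ univ.erase i₀, (|b i| - |a i|) := by
    rw [Finset.sum_sub_distrib]; linarith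
  rw [h1, h2]
  refine (Finset.abs_sum_le_sum_abs _ _).trans (Finset.sum_le_sum fun i _ => ?_)
  rw [abs_sub_comm (a i)]
  exact abs_abs_sub_abs_le _ _

lemma abs_sub_le_of_floor_eq {N y y' : ℝ} (hN : 0 < N) (h : ⌊N * y⌋ = ⌊N * y'⌋) :
    |y - y'| ≤ 1 / N := by
  have h1 := (Int.abs_sub_lt_one_of_floor_eq_floor h).le
  rw [← mul_sub, abs_mul, abs_of_pos hN] at h1
  rw [le_div_iff₀ hN]; linarith

open Classical in
/-- The cell of a parameter, at scale `1 / n`. -/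
noncomputable def cellCode {d : ℕ} (i₀ : Fin d) (n : ℕ) (θ : RidgeParam d) :
    Bool × Bool × (Fin d → ℤ) :=
  (decide (θ.sign = 1), decide (0 ≤ θ.dir i₀),
    fun i => ⌊((d * n : ℕ) : ℝ) * Function.update (fun j => θ.dir j) i₀ θ.offset i⌋)

lemma natAbs_floor_le (y : ℝ) : ((⌊y⌋.natAbs : ℕ) : ℝ) ≤ |y| + 1 := by
  rw [Nat.cast_natAbs, Int.cast_abs]
  have h1 := Int.floor_le y
  have h2 := Int.lt_floor_add_one y
  refine abs_le.2 ⟨?_, ?_⟩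
  · linarith [neg_abs_le y]
  · linarith [le_abs_self y]

/-- Direction and offset together have `ℓ¹` norm at most 2, hence `2 d n` after scaling; rounding
adds at most 1 per coordinate, in total `d ≤ d n`. -/
lemma cellCode_mem {d : ℕ} (i₀ : Fin d) {n : ℕ} (hn : 1 ≤ n) (θ : RidgeParam d) :
    (cellCode i₀ n θ).2.2 ∈ latticeBall d (3 * d * n) := by
  rw [mem_latticeBall]
  set y := Function.update (fun j => θ.dir j) i₀ θ.offset with hy
  have hsum : ∑ i, |y i| ≤ 2 := by
    rw [← Finset.add_sum_erase _ _ (Finset.mem_univ i₀)]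
    have e1 : |y i₀| ≤ 1 := by
      rw [hy, Function.update_self, abs_of_nonneg θ.offset_mem.1]; exact θ.offset_mem.2
    have e2 : ∑ i ∈ univ.erase i₀, |y i| ≤ 1 := by
      rw [← θ.dir_eq, l1Norm, ← Finset.add_sum_erase _ _ (Finset.mem_univ i₀)]
      have : ∑ i ∈ univ.erase i₀, |y i| = ∑ i ∈ univ.erase i₀, |θ.dir i| := by
        refine Finset.sum_congr rfl fun i hi => ?_
        rw [hy, Function.update_of_ne (Finset.ne_of_mem_erase hi)]
      rw [this]; linarith [abs_nonneg (θ.dir i₀)]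
    linarith
  have h : ((∑ i, (⌊((d * n : ℕ) : ℝ) * y i⌋).natAbs : ℕ) : ℝ) ≤ ((3 * d * n : ℕ) : ℝ) := by
    push_cast
    calc ∑ i, ((⌊(d : ℝ) * n * y i⌋.natAbs : ℕ) : ℝ)
        ≤ ∑ i, (d * n * |y i| + 1) := by
          refine Finset.sum_le_sum fun i _ => (natAbs_floor_le _).trans_eq ?_
          rw [abs_mul, abs_of_nonneg (by positivity)]
      _ = d * n * ∑ i, |y i| + d := by
          rw [Finset.sum_add_distrib, ← Finset.mul_sum]; simp
      _ ≤ d * n * 2 + d * n := by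
          gcongr
          have : (1 : ℝ) ≤ n := by exact_mod_cast hn
          nlinarith [(Nat.cast_nonneg d : (0 : ℝ) ≤ d)]
      _ = _ := by ring
  exact_mod_cast h

/-- The `d - 1` recorded coordinates cost `1 / (d n)` each, the omitted one costs at most their sum
again, and the offset one more: `(2 d - 1) / (d n)`. -/
lemma abs_ridge_sub_le_of_cellCode_eq {d : ℕ} (i₀ : Fin d) {n : ℕ} (hn : 1 ≤ n)
    {θ θ' : RidgeParam d} (h : cellCode i₀ n θ = cellCode i₀ n θ')
    {x : EuclideanSpace ℝ (Fin d)} (hx : x ∈ cube d) :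
    |θ.ridge x - θ'.ridge x| ≤ 2 / n := by
  simp only [cellCode, Prod.mk.injEq, decide_eq_decide] at h
  obtain ⟨h1, h2, h3⟩ := h
  have hd : (1 : ℝ) ≤ d := by
    have : 0 < d := i₀.pos
    exact_mod_cast this
  have hn' : (1 : ℝ) ≤ n := by exact_mod_cast hn
  have hN : (0 : ℝ) < ((d * n : ℕ) : ℝ) := by push_cast; positivity
  have hs : θ.sign = θ'.sign := by
    rcases θ.sign_eq with h | h <;> rcases θ'.sign_eq with h' | h' <;> rw [h, h'] at h1 ⊢ <;>
      norm_num at h1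
  have hy := fun i => abs_sub_le_of_floor_eq hN (congrFun h3 i)
  have ht : |θ.offset - θ'.offset| ≤ 1 / ((d * n : ℕ) : ℝ) := by simpa using hy i₀
  have hsum : ∑ i ∈ univ.erase i₀, |θ.dir i - θ'.dir i| ≤ (d - 1) * (1 / ((d * n : ℕ) : ℝ)) := by
    refine (Finset.sum_le_card_nsmul _ _ (1 / ((d * n : ℕ) : ℝ)) fun i hi => ?_).trans_eq ?_
    · have := hy i
      rwa [Function.update_of_ne (Finset.ne_of_mem_erase hi),
        Function.update_of_ne (Finset.ne_of_mem_erase hi)] at this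
    · rw [Finset.card_erase_of_mem (Finset.mem_univ _), Finset.card_univ, Fintype.card_fin,
        nsmul_eq_mul, Nat.cast_sub i₀.pos, Nat.cast_one]
  refine (RidgeParam.abs_ridge_sub_ridge_le hs hx).trans ?_
  have h0 := abs_sub_abs_le_sum θ.dir_eq θ'.dir_eq i₀ h2
  rw [l1Norm, ← Finset.add_sum_erase _ _ (Finset.mem_univ i₀)]
  simp only [PiLp.sub_apply]
  calc _ ≤ (d - 1) * (1 / ((d * n : ℕ) : ℝ)) + (d - 1) * (1 / ((d * n : ℕ) : ℝ)) +
        1 / ((d * n : ℕ) : ℝ) := by gcongr; exact h0.trans hsum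
    _ = (2 * d - 1) / d / n := by push_cast; field_simp; ring
    _ ≤ 2 / n := by
        gcongr
        rw [div_le_iff₀ (by positivity)]; linarith

/-- Pigeonhole: among `k * q` ridge functions there are `q` at mutual distance `O(k ^ (-1/d))`. -/
lemma exists_close_subset {d : ℕ} (hd : 1 ≤ d) {ι : Type*} (θ : ι → RidgeParam d)
    {k q : ℕ} (hk : 1 ≤ k) (S : Finset ι) (hS : k * q ≤ #S) :
    ∃ T ⊆ S, #T = q ∧ ∀ i ∈ T, ∀ j ∈ T, ∀ x ∈ cube d,
      |(θ i).ridge x - (θ j).ridge x| ≤ 1728 * (k : ℝ) ^ (-(1 / (d : ℝ))) := by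
  classical
  have hk' : (1 : ℝ) ≤ k := by exact_mod_cast hk
  set r := (k : ℝ) ^ (1 / (d : ℝ)) with hr
  have hr1 : 1 ≤ r := Real.one_le_rpow hk' (by positivity)
  rw [Real.rpow_neg (by positivity), ← hr, ← div_eq_mul_inv]
  -- Four sign classes times `(108 n) ^ d` lattice cells are at most `(432 n) ^ d ≤ r ^ d = k`
  -- cells. If `n = 0` then `r < 432` and the trivial bound 2 suffices; otherwise `r < 864 n`, so `2
  -- / n ≤ 1728 / r`.
  set n := ⌊r / 432⌋₊ with hn
  have hnr : (n : ℝ) ≤ r / 432 := Nat.floor_le (by positivity)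
  have hrn : r / 432 < n + 1 := Nat.lt_floor_add_one _
  rcases Nat.eq_zero_or_pos n with h0 | hpos
  · obtain ⟨T, hT, hTq⟩ := Finset.exists_subset_card_eq
      ((Nat.le_mul_of_pos_left q hk).trans hS)
    refine ⟨T, hT, hTq, fun i _ j _ x hx =>
      ((θ i).abs_ridge_sub_ridge_le_two (θ j) hx).trans ?_⟩
    rw [h0, Nat.cast_zero] at hrn
    rw [le_div_iff₀ (by positivity)]; linarith
  · have hn1 : (1 : ℝ) ≤ n := by exact_mod_cast hpos
    set i₀ : Fin d := ⟨0, hd⟩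
    set B : Finset (Bool × Bool × (Fin d → ℤ)) :=
      univ ×ˢ univ ×ˢ latticeBall d (3 * d * n) with hB
    have hBk : #B ≤ k := by
      have h1 : (#B : ℝ) ≤ k := by
        rw [hB, Finset.card_product, Finset.card_product]
        simp only [Finset.card_univ, Fintype.card_bool]
        push_cast
        calc (2 : ℝ) * (2 * #(latticeBall d (3 * d * n))) ≤ 4 ^ d * (108 * n) ^ d := by
              have h4 : (4 : ℝ) ≤ 4 ^ d := le_self_pow₀ (by norm_num) (by omega)
              have := card_latticeBall_le (d := d) hpos
              have := mul_le_mul h4 this (by positivity) (by positivity)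
              linarith
          _ = (432 * n) ^ d := by rw [← mul_pow]; ring
          _ ≤ r ^ d := by gcongr; linarith
          _ = k := by
              rw [hr, one_div, Real.rpow_inv_natCast_pow (by positivity) (by omega)]
      exact_mod_cast h1
    have hmaps : ∀ i ∈ S, cellCode i₀ n (θ i) ∈ B := fun i _ => by
      rw [hB, Finset.mem_product, Finset.mem_product]
      exact ⟨Finset.mem_univ _, Finset.mem_univ _, cellCode_mem i₀ hpos _⟩
    have hBne : B.Nonempty := by
      refine Finset.univ_nonempty.product (Finset.univ_nonempty.product ⟨0, ?_⟩)
      rw [mem_latticeBall]; simp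
    obtain ⟨y, -, hy⟩ := Finset.exists_le_card_fiber_of_mul_le_card_of_maps_to hmaps hBne
      ((Nat.mul_le_mul_right q hBk).trans hS)
    obtain ⟨T, hT, hTq⟩ := Finset.exists_subset_card_eq hy
    refine ⟨T, hT.trans (Finset.filter_subset _ _), hTq, fun i hi j hj x hx => ?_⟩
    have hi' := (Finset.mem_filter.1 (hT hi)).2
    have hj' := (Finset.mem_filter.1 (hT hj)).2
    refine (abs_ridge_sub_le_of_cellCode_eq i₀ hpos (hi'.trans hj'.symm) hx).trans ?_
    rw [div_le_div_iff₀ (by positivity) (by positivity)]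
    linarith

/-! ### Grouping -/

/-- The identity for every `φ` says that `g` enumerates its set exactly once, without carrying an
equivalence along. `T` becomes the last group. -/
lemma exists_grouping_succ {ι : Type*} [DecidableEq ι] {S T : Finset ι} (hTS : T ⊆ S) {m q : ℕ}
    (hT : #T = q) (g : Fin m → Fin q → ι)
    (hg : ∀ φ : ι → ℝ, ∑ s ∈ S \ T, φ s = ∑ k, ∑ i, φ (g k i)) :
    ∃ g' : Fin (m + 1) → Fin q → ι, (∀ φ : ι → ℝ, ∑ s ∈ S, φ s = ∑ k, ∑ i, φ (g' k i)) ∧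
      (∀ k : Fin m, g' k.castSucc = g k) ∧ ∀ i, g' (Fin.last m) i ∈ T := by
  set e := T.equivFinOfCardEq hT
  refine ⟨Fin.snoc (α := fun _ => Fin q → ι) g (fun i => (e.symm i : ι)), fun φ => ?_,
    fun k => by simp, fun i => by simp⟩
  rw [Fin.sum_univ_castSucc]
  simp only [Fin.snoc_castSucc, Fin.snoc_last]
  rw [← hg, ← Finset.sum_sdiff hTS, ← Finset.sum_coe_sort T,
    ← Equiv.sum_comp e.symm (fun t : T => φ t)]

/-- Greedy grouping of `m * q` ridge functions into `m` groups of `q`. -/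
lemma exists_greedy_grouping {d : ℕ} (hd : 1 ≤ d) {ι : Type*} (θ : ι → RidgeParam d) {q : ℕ}
    (m : ℕ) : ∀ S : Finset ι, #S = m * q → ∃ g : Fin m → Fin q → ι,
      (∀ φ : ι → ℝ, ∑ s ∈ S, φ s = ∑ k, ∑ i, φ (g k i)) ∧
      ∀ k i j, ∀ x ∈ cube d, |(θ (g k i)).ridge x - (θ (g k j)).ridge x| ≤
        1728 * (((k : ℕ) + 1 : ℕ) : ℝ) ^ (-(1 / (d : ℝ))) := by
  classical
  induction m with
  | zero =>
    intro S hS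
    have : S = ∅ := by simpa using hS
    exact ⟨fun k => k.elim0, by simp [this], fun k => k.elim0⟩
  | succ m ih =>
    intro S hS
    -- Group `k` is extracted when `(k + 1) q` functions remain; the last index therefore gets the
    -- smallest diameter bound.
    obtain ⟨T, hTS, hT, hclose⟩ := exists_close_subset hd θ (k := m + 1) (by omega) S hS.ge
    obtain ⟨g, hg, hgδ⟩ := ih (S \ T) (by
      rw [Finset.card_sdiff_of_subset hTS, hS, hT, Nat.succ_mul, Nat.add_sub_cancel])
    obtain ⟨g', hg', h1, h2⟩ := exists_grouping_succ hTS hT g hg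
    refine ⟨g', hg', fun k => ?_⟩
    refine Fin.lastCases (fun i j => ?_) (fun k => ?_) k
    · exact hclose _ (h2 i) _ (h2 j)
    · rw [h1]; exact hgδ k

lemma exists_top_subset {ι : Type*} [DecidableEq ι] (c : ι → ℕ) (S : Finset ι) (q : ℕ)
    (hq : q ≤ #S) : ∃ T ⊆ S, #T = q ∧ ∀ i ∈ T, ∀ j ∈ S \ T, c j ≤ c i := by
  induction q with
  | zero => exact ⟨∅, Finset.empty_subset _, rfl, by simp⟩
  | succ q ih =>
    obtain ⟨T, hTS, hT, h⟩ := ih (by omega)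
    have hne : (S \ T).Nonempty := by
      rw [← Finset.card_pos, Finset.card_sdiff_of_subset hTS]; omega
    obtain ⟨a, ha, hmax⟩ := Finset.exists_max_image (S \ T) c hne
    obtain ⟨haS, haT⟩ := Finset.mem_sdiff.1 ha
    refine ⟨insert a T, Finset.insert_subset haS hTS, by rw [Finset.card_insert_of_notMem haT, hT],
      fun i hi j hj => ?_⟩
    have hj' : j ∈ S \ T := by
      rw [Finset.mem_sdiff] at hj ⊢
      exact ⟨hj.1, fun h => hj.2 (Finset.mem_insert_of_mem h)⟩
    rcases Finset.mem_insert.1 hi with rfl | hi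
    · exact hmax j hj'
    · exact h i hi j hj'

/-- Grouping along a linear order: if squared distances are controlled by differences of codes,
then consecutive groups have a controlled sum of squared diameters. -/
lemma exists_ordered_grouping {ι α : Type*} (D : ι → ι → α → ℝ) (X : Set α) (c : ι → ℕ) {A : ℝ}
    (hA : 0 ≤ A) (hD : ∀ i j, c j ≤ c i → ∀ x ∈ X, D i j x ^ 2 ≤ A * ((c i : ℝ) - c j + 1))
    (hD' : ∀ i j x, |D i j x| = |D j i x|) {q : ℕ} (hq : 0 < q) (m : ℕ) :
    ∀ (B : ℕ) (S : Finset ι), #S = m * q → (∀ i ∈ S, c i ≤ B) →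
      ∃ (g : Fin m → Fin q → ι) (δ : Fin m → ℝ),
        (∀ φ : ι → ℝ, ∑ s ∈ S, φ s = ∑ k, ∑ i, φ (g k i)) ∧
        (∀ k i j, ∀ x ∈ X, |D (g k i) (g k j) x| ≤ δ k) ∧
        ∑ k, δ k ^ 2 ≤ A * (B + m) := by
  classical
  induction m with
  | zero =>
    intro B S hS _
    have : S = ∅ := by simpa using hS
    exact ⟨fun k => k.elim0, fun k => k.elim0, by simp [this], fun k => k.elim0,
      by simp; positivity⟩
  | succ m ih =>
    intro B S hS hB
    obtain ⟨T, hTS, hT, htop⟩ := exists_top_subset c S q (by rw [hS]; exact Nat.le_mul_of_pos_left q (by omega))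
    -- The least code of the top group bounds all remaining codes, so the estimates telescope: `A (B
    -- - c a + 1) + A (c a + m) = A (B + m + 1)`.
    obtain ⟨a, ha, hmin⟩ := Finset.exists_min_image T c (Finset.card_pos.1 (by omega))
    obtain ⟨g, δ, hg, hgδ, hsum⟩ := ih (c a) (S \ T) (by
      rw [Finset.card_sdiff_of_subset hTS, hS, hT, Nat.succ_mul, Nat.add_sub_cancel])
      (fun j hj => htop a ha j hj)
    obtain ⟨g', hg', h1, h2⟩ := exists_grouping_succ hTS hT g hg
    have haB : (c a : ℝ) ≤ B := by exact_mod_cast hB a (hTS ha)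
    have hnn : 0 ≤ A * ((B : ℝ) - c a + 1) := mul_nonneg hA (by linarith)
    refine ⟨g', Fin.snoc (α := fun _ => ℝ) δ √(A * ((B : ℝ) - c a + 1)), hg', fun k => ?_, ?_⟩
    · refine Fin.lastCases (fun i j x hx => ?_) (fun k => ?_) k
      · rw [Fin.snoc_last]
        have key : ∀ i ∈ T, ∀ j ∈ T, c j ≤ c i →
            |D i j x| ≤ √(A * ((B : ℝ) - c a + 1)) := by
          intro i hi j hj hij
          refine Real.abs_le_sqrt ((hD i j hij x hx).trans ?_)
          have e1 : (c i : ℝ) ≤ B := by exact_mod_cast hB i (hTS hi)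
          have e2 : (c a : ℝ) ≤ c j := by exact_mod_cast hmin j hj
          gcongr
        rcases le_total (c (g' (Fin.last m) j)) (c (g' (Fin.last m) i)) with h | h
        · exact key _ (h2 i) _ (h2 j) h
        · rw [hD']; exact key _ (h2 j) _ (h2 i) h
      · rw [h1, Fin.snoc_castSucc]; exact hgδ k
    · rw [Fin.sum_univ_castSucc]
      simp only [Fin.snoc_castSucc, Fin.snoc_last]
      rw [Real.sq_sqrt hnn]
      push_cast
      linarith

end RidgeApprox

namespace RidgeApprox

open Finset

/-! ### The Hilbert curve -/

/-- The `i`-th cell visited by the Hilbert curve of order `L` in the grid `[0, 2 ^ L)²`. -/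
def hilbert : ℕ → ℕ → ℤ × ℤ
  | 0, _ => (0, 0)
  | L + 1, i =>
    let p := hilbert L (i % 4 ^ L)
    if i / 4 ^ L = 0 then (p.2, p.1)
    else if i / 4 ^ L = 1 then (p.1, p.2 + 2 ^ L)
    else if i / 4 ^ L = 2 then (p.1 + 2 ^ L, p.2 + 2 ^ L)
    else (2 * 2 ^ L - 1 - p.2, 2 ^ L - 1 - p.1)

lemma hilbert_add_zero (L r : ℕ) (hr : r < 4 ^ L) :
    hilbert (L + 1) r = ((hilbert L r).2, (hilbert L r).1) := by
  simp [hilbert, Nat.div_eq_of_lt hr, Nat.mod_eq_of_lt hr]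

lemma hilbert_add_one (L r : ℕ) (hr : r < 4 ^ L) :
    hilbert (L + 1) (4 ^ L + r) = ((hilbert L r).1, (hilbert L r).2 + 2 ^ L) := by
  have h : (4 ^ L + r) / 4 ^ L = 1 := by
    rw [Nat.add_div_left _ (by positivity), Nat.div_eq_of_lt hr]
  simp [hilbert, h, Nat.mod_eq_of_lt hr]

lemma hilbert_add_two (L r : ℕ) (hr : r < 4 ^ L) :
    hilbert (L + 1) (4 ^ L * 2 + r) = ((hilbert L r).1 + 2 ^ L, (hilbert L r).2 + 2 ^ L) := by
  have h : (4 ^ L * 2 + r) / 4 ^ L = 2 := by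
    rw [Nat.mul_add_div (by positivity), Nat.div_eq_of_lt hr]
  simp [hilbert, h, Nat.mod_eq_of_lt hr]

lemma hilbert_add_three (L r : ℕ) (hr : r < 4 ^ L) :
    hilbert (L + 1) (4 ^ L * 3 + r) =
      (2 * 2 ^ L - 1 - (hilbert L r).2, 2 ^ L - 1 - (hilbert L r).1) := by
  have h : (4 ^ L * 3 + r) / 4 ^ L = 3 := by
    rw [Nat.mul_add_div (by positivity), Nat.div_eq_of_lt hr]
  simp [hilbert, h, Nat.mod_eq_of_lt hr]

/-- Splitting an index of order `L + 1` into quadrant and remainder. -/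
lemma exists_quadrant {L i : ℕ} (hi : i < 4 ^ (L + 1)) :
    ∃ r < 4 ^ L, i = r ∨ i = 4 ^ L + r ∨ i = 4 ^ L * 2 + r ∨ i = 4 ^ L * 3 + r := by
  refine ⟨i % 4 ^ L, Nat.mod_lt _ (by positivity), ?_⟩
  have h1 : i / 4 ^ L < 4 := by
    rw [Nat.div_lt_iff_lt_mul (by positivity)]
    rw [pow_succ] at hi; omega
  have h2 := Nat.div_add_mod i (4 ^ L)
  generalize i / 4 ^ L = a at h1 h2
  interval_cases a <;> omega

lemma hilbert_mem {L i : ℕ} (hi : i < 4 ^ L) :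
    (0 ≤ (hilbert L i).1 ∧ (hilbert L i).1 < 2 ^ L) ∧
      (0 ≤ (hilbert L i).2 ∧ (hilbert L i).2 < 2 ^ L) := by
  induction L generalizing i with
  | zero => simp [hilbert]
  | succ L ih =>
    obtain ⟨r, hr, h⟩ := exists_quadrant hi
    have h0 := ih hr
    rcases h with rfl | rfl | rfl | rfl
    · rw [hilbert_add_zero _ _ hr, pow_succ]; simp only; omega
    · rw [hilbert_add_one _ _ hr, pow_succ]; simp only; omega
    · rw [hilbert_add_two _ _ hr, pow_succ]; simp only; omega
    · rw [hilbert_add_three _ _ hr, pow_succ]; simp only; omega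

lemma hilbert_first (L : ℕ) : hilbert L 0 = (0, 0) := by
  induction L with
  | zero => rfl
  | succ L ih => rw [hilbert_add_zero _ _ (by positivity), ih]

lemma hilbert_last (L : ℕ) : hilbert L (4 ^ L - 1) = (2 ^ L - 1, 0) := by
  induction L with
  | zero => simp [hilbert]
  | succ L ih =>
    have h4 : 0 < 4 ^ L := by positivity
    have e : 4 ^ (L + 1) - 1 = 4 ^ L * 3 + (4 ^ L - 1) := by rw [pow_succ]; omega
    rw [e, hilbert_add_three _ _ (by omega), ih, pow_succ]
    ext
    · simp; ring
    · simp

/-- Inside a quadrant this is inductive. At the three seams the reflected copies meet because the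
curve starts at `(0, 0)` and ends at `(2 ^ L - 1, 0)`. -/
lemma hilbert_step {L i : ℕ} (hi : i + 1 < 4 ^ L) :
    |(hilbert L (i + 1)).1 - (hilbert L i).1| ≤ 1 ∧
      |(hilbert L (i + 1)).2 - (hilbert L i).2| ≤ 1 := by
  induction L generalizing i with
  | zero => simp at hi
  | succ L ih =>
    obtain ⟨r, hr, h⟩ := exists_quadrant (Nat.lt_of_succ_lt hi)
    rcases Nat.lt_or_ge (r + 1) (4 ^ L) with hr1 | hr1
    · have h0 := ih hr1
      simp only [abs_le] at h0 ⊢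
      rcases h with rfl | rfl | rfl | rfl
      · rw [hilbert_add_zero _ _ hr, hilbert_add_zero _ _ hr1]; simp only; omega
      · rw [hilbert_add_one _ _ hr, add_assoc, hilbert_add_one _ _ hr1]; simp only; omega
      · rw [hilbert_add_two _ _ hr, add_assoc, hilbert_add_two _ _ hr1]; simp only; omega
      · rw [hilbert_add_three _ _ hr, add_assoc, hilbert_add_three _ _ hr1]; simp only; omega
    · have h4 : 0 < 4 ^ L := by positivity
      have hrl : r = 4 ^ L - 1 := by omega
      have hl := hilbert_last L
      rw [← hrl] at hl
      have hf := hilbert_first L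
      simp only [abs_le]
      rcases h with rfl | rfl | rfl | rfl
      · have e : i + 1 = 4 ^ L + 0 := by omega
        rw [e, hilbert_add_zero _ _ hr, hilbert_add_one _ _ h4, hl, hf]; simp only; omega
      · have e : 4 ^ L + r + 1 = 4 ^ L * 2 + 0 := by omega
        rw [e, hilbert_add_one _ _ hr, hilbert_add_two _ _ h4, hl, hf]; simp only; omega
      · have e : 4 ^ L * 2 + r + 1 = 4 ^ L * 3 + 0 := by omega
        rw [e, hilbert_add_two _ _ hr, hilbert_add_three _ _ h4, hl, hf]; simp only; omega
      · rw [pow_succ] at hi; omega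

lemma hilbert_surj {L : ℕ} {a b : ℤ} (ha0 : 0 ≤ a) (ha : a < 2 ^ L) (hb0 : 0 ≤ b)
    (hb : b < 2 ^ L) : ∃ i < 4 ^ L, hilbert L i = (a, b) := by
  induction L generalizing a b with
  | zero =>
    refine ⟨0, by simp, ?_⟩
    simp only [pow_zero] at ha hb
    ext <;> simp [hilbert] <;> omega
  | succ L ih =>
    rw [pow_succ] at ha hb
    rw [pow_succ]
    rcases lt_or_ge a (2 ^ L) with h1 | h1 <;> rcases lt_or_ge b (2 ^ L) with h2 | h2
    · obtain ⟨i, hi, h⟩ := ih hb0 h2 ha0 h1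
      exact ⟨i, by omega, by rw [hilbert_add_zero _ _ hi, h]⟩
    · obtain ⟨i, hi, h⟩ := ih ha0 h1 (b := b - 2 ^ L) (by omega) (by omega)
      exact ⟨4 ^ L + i, by omega, by rw [hilbert_add_one _ _ hi, h]; simp⟩
    · obtain ⟨i, hi, h⟩ := ih (a := 2 ^ L - 1 - b) (b := 2 * 2 ^ L - 1 - a)
        (by omega) (by omega) (by omega) (by omega)
      exact ⟨4 ^ L * 3 + i, by omega, by rw [hilbert_add_three _ _ hi, h]; simp⟩
    · obtain ⟨i, hi, h⟩ := ih (a := a - 2 ^ L) (b := b - 2 ^ L)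
        (by omega) (by omega) (by omega) (by omega)
      exact ⟨4 ^ L * 2 + i, by omega, by rw [hilbert_add_two _ _ hi, h]; simp⟩

/-- A block of `4 ^ j` consecutive indices fills a subsquare of side `2 ^ j`. Since `4 ^ j` divides
`4 ^ L`, a block stays in one quadrant, and the quadrant maps only swap, reflect and translate
coordinates. -/
lemma hilbert_block {L j i i' : ℕ} (hj : j ≤ L) (hi : i < 4 ^ L) (hi' : i' < 4 ^ L)
    (h : i / 4 ^ j = i' / 4 ^ j) :
    |(hilbert L i).1 - (hilbert L i').1| < 2 ^ j ∧ |(hilbert L i).2 - (hilbert L i').2| < 2 ^ j := by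
  induction L, hj using Nat.le_induction generalizing i i' with
  | base =>
    have h1 := hilbert_mem hi
    have h2 := hilbert_mem hi'
    simp only [abs_lt]; omega
  | succ L hj ih =>
    obtain ⟨r, hr, hir⟩ := exists_quadrant hi
    obtain ⟨r', hr', hir'⟩ := exists_quadrant hi'
    obtain ⟨K, hK⟩ : ∃ K, L = j + K := ⟨L - j, by omega⟩
    have h4 : (4 : ℕ) ^ L = 4 ^ j * 4 ^ K := by rw [hK, pow_add]
    have hpos : 0 < 4 ^ j := by positivity
    have hdiv : ∀ r < 4 ^ L, r / 4 ^ j < 4 ^ K := fun r hr => by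
      rw [Nat.div_lt_iff_lt_mul hpos]; rw [h4] at hr; linarith
    have hd := hdiv r hr
    have hd' := hdiv r' hr'
    have e1 : ∀ r, (4 ^ L + r) / 4 ^ j = 4 ^ K + r / 4 ^ j := fun r => by
      rw [h4, Nat.mul_add_div hpos]
    have e2 : ∀ r, (4 ^ L * 2 + r) / 4 ^ j = 4 ^ K * 2 + r / 4 ^ j := fun r => by
      rw [h4, mul_assoc, Nat.mul_add_div hpos]
    have e3 : ∀ r, (4 ^ L * 3 + r) / 4 ^ j = 4 ^ K * 3 + r / 4 ^ j := fun r => by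
      rw [h4, mul_assoc, Nat.mul_add_div hpos]
    have key : r / 4 ^ j = r' / 4 ^ j → _ := ih hr hr'
    obtain ⟨a, ha⟩ : ∃ a, r / 4 ^ j = a := ⟨_, rfl⟩
    obtain ⟨a', ha'⟩ : ∃ a, r' / 4 ^ j = a := ⟨_, rfl⟩
    rw [ha] at hd
    rw [ha'] at hd'
    rw [ha, ha'] at key
    simp only [abs_lt] at key ⊢
    rcases hir with rfl | rfl | rfl | rfl <;> rcases hir' with rfl | rfl | rfl | rfl
    all_goals simp only [e1, e2, e3, ha, ha'] at h
    all_goals try (exfalso; omega)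
    · have := key h
      rw [hilbert_add_zero _ _ hr, hilbert_add_zero _ _ hr']; simp only; omega
    · have := key (by omega)
      rw [hilbert_add_one _ _ hr, hilbert_add_one _ _ hr']; simp only; omega
    · have := key (by omega)
      rw [hilbert_add_two _ _ hr, hilbert_add_two _ _ hr']; simp only; omega
    · have := key (by omega)
      rw [hilbert_add_three _ _ hr, hilbert_add_three _ _ hr']; simp only; omega

/-- The Hilbert curve is Hölder continuous of exponent `1 / 2`. -/
lemma hilbert_holder {L i i' : ℕ} (hi : i ≤ i') (hi' : i' < 4 ^ L) :
    ((hilbert L i').1 - (hilbert L i).1) ^ 2 ≤ 16 * ((i' : ℤ) - i) ∧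
      ((hilbert L i').2 - (hilbert L i).2) ^ 2 ≤ 16 * ((i' : ℤ) - i) := by
  rcases hi.eq_or_lt with rfl | hlt
  · simp
  set n := i' - i with hn
  have hn0 : n ≠ 0 := by omega
  -- The least scale with `n < 4 ^ j`: the two indices lie in the same or in adjacent blocks, so
  -- their cells differ by at most `2 * 2 ^ j` per coordinate, and `(2 * 2 ^ j) ^ 2 = 16 * 4 ^ (j -
  -- 1) ≤ 16 n`.
  set j := Nat.log 4 n + 1 with hjdef
  have hlow : 4 ^ (j - 1) ≤ n := Nat.pow_log_le_self 4 hn0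
  have hup : n < 4 ^ j := Nat.lt_pow_succ_log_self (by norm_num) n
  have hjL : j ≤ L := by
    have := Nat.log_lt_of_lt_pow (b := 4) (x := L) hn0 (by omega)
    omega
  have hpos : 0 < 4 ^ j := by positivity
  have key : |(hilbert L i').1 - (hilbert L i).1| ≤ 2 * 2 ^ j ∧
      |(hilbert L i').2 - (hilbert L i).2| ≤ 2 * 2 ^ j := by
    have h2 : (0 : ℤ) < 2 ^ j := by positivity
    by_cases h : i / 4 ^ j = i' / 4 ^ j
    · have := hilbert_block hjL (hi.trans_lt hi') hi' h
      simp only [abs_le, abs_lt] at this ⊢; omega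
    · have h1 : i / 4 ^ j ≤ i' / 4 ^ j := Nat.div_le_div_right hi
      have e1 := Nat.div_add_mod i' (4 ^ j)
      have e2 := Nat.div_add_mod i (4 ^ j)
      have e3 := Nat.mod_lt i hpos
      have e4 := Nat.mod_lt i' hpos
      have hle : i' / 4 ^ j < i / 4 ^ j + 2 := by
        by_contra hcon
        have := Nat.mul_le_mul_left (4 ^ j) (not_lt.1 hcon)
        rw [mul_add] at this; omega
      have hb : i' / 4 ^ j = i / 4 ^ j + 1 := by omega
      set e := 4 ^ j * (i / 4 ^ j + 1) with he
      have he' : e = 4 ^ j * (i / 4 ^ j) + 4 ^ j := by rw [he, mul_add, mul_one]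
      rw [hb, ← he] at e1
      have b1 := hilbert_block (i := i) (i' := e - 1) hjL (hi.trans_lt hi') (by omega) (by
        rw [show e - 1 = 4 ^ j * (i / 4 ^ j) + (4 ^ j - 1) by omega, Nat.mul_add_div hpos,
          Nat.div_eq_of_lt (a := 4 ^ j - 1) (by omega), add_zero])
      have b2 := hilbert_block (i := e) (i' := i') hjL (by omega) hi' (by
        rw [hb, he, Nat.mul_div_cancel_left _ hpos])
      have b3 := hilbert_step (L := L) (i := e - 1) (by omega)
      rw [Nat.sub_add_cancel (by omega)] at b3
      simp only [abs_le, abs_lt] at b1 b2 b3 ⊢; omega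
  have hfin : ((2 : ℤ) * 2 ^ j) ^ 2 ≤ 16 * ((i' : ℤ) - i) := by
    have h1 : ((2 : ℤ) * 2 ^ j) ^ 2 = 16 * ((4 ^ (j - 1) : ℕ) : ℤ) := by
      have : j = (j - 1) + 1 := by omega
      rw [mul_pow, ← pow_mul, mul_comm j 2, pow_mul, this]
      push_cast
      rw [pow_succ, Nat.add_sub_cancel]; ring
    have h2 : ((4 ^ (j - 1) : ℕ) : ℤ) ≤ (n : ℤ) := by exact_mod_cast hlow
    rw [h1]; omega
  exact ⟨(sq_le_sq' (abs_le.1 key.1).1 (abs_le.1 key.1).2).trans hfin,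
    (sq_le_sq' (abs_le.1 key.2).1 (abs_le.1 key.2).2).trans hfin⟩

end RidgeApprox

namespace RidgeApprox

open Finset

/-! ### Ordering the parameters of the plane along the Hilbert curve -/

/-- The cell of `y ∈ [0, 1]` among `2 ^ L` equal intervals. -/
noncomputable def dyadicCell (L : ℕ) (y : ℝ) : ℤ := min ⌊2 ^ L * y⌋ (2 ^ L - 1)

lemma dyadicCell_nonneg {L : ℕ} {y : ℝ} (hy : y ∈ Set.Icc (0 : ℝ) 1) : 0 ≤ dyadicCell L y := by
  have h1 : (0 : ℤ) ≤ ⌊2 ^ L * y⌋ := Int.floor_nonneg.2 (mul_nonneg (by positivity) hy.1)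
  have h2 : (0 : ℤ) < 2 ^ L := by positivity
  exact le_min h1 (by omega)

lemma dyadicCell_lt (L : ℕ) (y : ℝ) : dyadicCell L y < 2 ^ L :=
  (min_le_right _ _).trans_lt (by omega)

/-- The truncation in `dyadicCell` puts `y = 1` into the last cell, so the upper inequality cannot
be strict. -/
lemma dyadicCell_bounds {L : ℕ} {y : ℝ} (hy : y ∈ Set.Icc (0 : ℝ) 1) :
    (dyadicCell L y : ℝ) ≤ 2 ^ L * y ∧ 2 ^ L * y ≤ dyadicCell L y + 1 := by
  constructor
  · refine le_trans ?_ (Int.floor_le _)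
    exact Int.cast_le.2 (min_le_left _ _)
  · rcases min_choice ⌊2 ^ L * y⌋ (2 ^ L - 1) with h | h
    · rw [dyadicCell, h]; exact (Int.lt_floor_add_one _).le
    · rw [dyadicCell, h]
      push_cast
      have := mul_le_mul_of_nonneg_left hy.2 (by positivity : (0 : ℝ) ≤ 2 ^ L)
      linarith

lemma sq_sub_le_of_dyadicCell {L : ℕ} {y y' n : ℝ} (hy : y ∈ Set.Icc (0 : ℝ) 1)
    (hy' : y' ∈ Set.Icc (0 : ℝ) 1)
    (h : ((dyadicCell L y - dyadicCell L y' : ℤ) : ℝ) ^ 2 ≤ 16 * n) :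
    (y - y') ^ 2 ≤ 32 * (n + 1) / 4 ^ L := by
  have h1 := dyadicCell_bounds (L := L) hy
  have h2 := dyadicCell_bounds (L := L) hy'
  push_cast at h
  set a : ℝ := (dyadicCell L y : ℝ)
  set b : ℝ := (dyadicCell L y' : ℝ)
  have h4 : (4 : ℝ) ^ L = 2 ^ L * 2 ^ L := by rw [← mul_pow]; norm_num
  rw [le_div_iff₀ (by positivity), h4]
  have e : (y - y') ^ 2 * (2 ^ L * 2 ^ L) = (2 ^ L * y - 2 ^ L * y') ^ 2 := by ring
  rw [e]
  have h5 : |2 ^ L * y - 2 ^ L * y'| ≤ |a - b| + 1 := by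
    rcases abs_cases (a - b) with h | h <;> refine abs_le.2 ⟨by linarith, by linarith⟩
  have h6 := pow_le_pow_left₀ (abs_nonneg _) h5 2
  rw [sq_abs] at h6
  have h7 := sq_abs (a - b)
  nlinarith [sq_nonneg (|a - b| - 1)]

/-- An enumeration of the parameters for `d = 2` that is `1 / 2`-Hölder. -/
lemma exists_holder_code (L : ℕ) : ∃ c : RidgeParam 2 → ℕ, (∀ θ, c θ ≤ 8 * 4 ^ L) ∧
    ∀ θ θ', c θ' ≤ c θ → ∀ x ∈ cube 2,
      (θ.ridge x - θ'.ridge x) ^ 2 ≤ 800 / 4 ^ L * ((c θ : ℝ) - c θ' + 1) := by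
  classical
  have hy1 : ∀ θ : RidgeParam 2, (θ.dir 0 + 1) / 2 ∈ Set.Icc (0 : ℝ) 1 := by
    intro θ
    have h := θ.dir_eq
    rw [l1Norm, Fin.sum_univ_two] at h
    have h1 := abs_nonneg (θ.dir 1)
    have h2 := abs_le.1 (show |θ.dir 0| ≤ 1 by linarith)
    exact ⟨by linarith [h2.1], by linarith [h2.2]⟩
  have hex := fun θ : RidgeParam 2 => hilbert_surj (L := L)
    (dyadicCell_nonneg (hy1 θ)) (dyadicCell_lt L ((θ.dir 0 + 1) / 2))
    (dyadicCell_nonneg θ.offset_mem) (dyadicCell_lt L θ.offset)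
  choose p hp hpeq using hex
  -- Within one of these four classes a parameter is determined by a point of the unit square: the
  -- rescaled first coordinate and the offset.
  set cls : RidgeParam 2 → ℕ := fun θ =>
    (if θ.sign = 1 then 1 else 0) + (if 0 ≤ θ.dir 1 then 2 else 0) with hcls
  have hcls3 : ∀ θ, cls θ ≤ 3 := by
    intro θ; simp only [hcls]; split_ifs <;> omega
  -- Classes are spaced by `2 * 4 ^ L` while `p θ < 4 ^ L`. Codes of different classes thus differ
  -- by at least `4 ^ L`, where the trivial distance bound 2 is enough.
  refine ⟨fun θ => cls θ * (2 * 4 ^ L) + p θ, fun θ => ?_, fun θ θ' hle x hx => ?_⟩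
  · have := Nat.mul_le_mul_right (2 * 4 ^ L) (hcls3 θ)
    have := hp θ
    simp only; omega
  have h4 : (0 : ℝ) < 4 ^ L := by positivity
  rw [div_mul_eq_mul_div]
  simp only at hle
  by_cases hc : cls θ = cls θ'
  · simp only [hc] at hle ⊢
    have hpp : p θ' ≤ p θ := by omega
    have hs' : (θ.sign = 1 ↔ θ'.sign = 1) ∧ (0 ≤ θ.dir 1 ↔ 0 ≤ θ'.dir 1) := by
      simp only [hcls] at hc
      by_cases a1 : θ.sign = 1 <;> by_cases a2 : θ'.sign = 1 <;>
        by_cases a3 : 0 ≤ θ.dir 1 <;> by_cases a4 : 0 ≤ θ'.dir 1 <;>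
        simp only [a1, a2, a3, a4, if_true, if_false] at hc ⊢ <;> simp at hc ⊢
    have hs : θ.sign = θ'.sign ∧ (0 ≤ θ.dir 1 ↔ 0 ≤ θ'.dir 1) := by
      refine ⟨?_, hs'.2⟩
      have h1 := hs'.1
      rcases θ.sign_eq with h | h <;> rcases θ'.sign_eq with h' | h' <;> rw [h, h'] at h1 ⊢ <;>
        norm_num at h1
    push_cast
    set n : ℝ := (p θ : ℝ) - p θ' with hn
    have hn0 : 0 ≤ n := by
      have : (p θ' : ℝ) ≤ p θ := by exact_mod_cast hpp
      linarith
    have e : (cls θ' : ℝ) * (2 * 4 ^ L) + p θ - (cls θ' * (2 * 4 ^ L) + p θ') = n := by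
      rw [hn]; ring
    rw [e]
    have hh := hilbert_holder hpp (hp θ)
    rw [hpeq, hpeq] at hh
    have hh1 : ((dyadicCell L ((θ.dir 0 + 1) / 2) - dyadicCell L ((θ'.dir 0 + 1) / 2) : ℤ) : ℝ) ^ 2
        ≤ 16 * n := by
      have h := (Int.cast_le (R := ℝ)).2 hh.1
      rw [hn]
      push_cast at h ⊢
      exact h
    have hh2 : ((dyadicCell L θ.offset - dyadicCell L θ'.offset : ℤ) : ℝ) ^ 2
        ≤ 16 * n := by rw [hn]; exact_mod_cast hh.2
    have b1 := sq_sub_le_of_dyadicCell (hy1 θ) (hy1 θ') hh1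
    have b2 := sq_sub_le_of_dyadicCell θ.offset_mem θ'.offset_mem hh2
    have b3 := RidgeParam.abs_ridge_sub_ridge_le hs.1 hx
    have b4 := abs_sub_abs_le_sum θ.dir_eq θ'.dir_eq 1 hs.2
    have b5 : ∑ i ∈ univ.erase (1 : Fin 2), |θ.dir i - θ'.dir i| = |θ.dir 0 - θ'.dir 0| := by
      rw [show univ.erase (1 : Fin 2) = {0} by decide, Finset.sum_singleton]
    rw [b5] at b4
    rw [l1Norm, Fin.sum_univ_two] at b3
    simp only [PiLp.sub_apply] at b3
    set u := |θ.dir 0 - θ'.dir 0| with hu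
    set w := |θ.offset - θ'.offset| with hw
    have hu2 : u ^ 2 ≤ 4 * (32 * (n + 1) / 4 ^ L) := by
      rw [hu, sq_abs]; nlinarith
    have hw2 : w ^ 2 ≤ 32 * (n + 1) / 4 ^ L := by rw [hw, sq_abs]; exact b2
    have b6 : |θ.ridge x - θ'.ridge x| ≤ 2 * u + w := by linarith
    have b7 := pow_le_pow_left₀ (abs_nonneg _) b6 2
    rw [sq_abs] at b7
    -- With `K = 32 (n + 1) / 4 ^ L`, the bounds are `u ^ 2 ≤ 4 K` (the coordinate was halved) and
    -- `w ^ 2 ≤ K`. Cauchy–Schwarz gives `(2 u + w) ^ 2 ≤ 5 (u ^ 2 + w ^ 2) ≤ 25 K`.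
    have e2 : 800 * (n + 1) / 4 ^ L = 25 * (32 * (n + 1) / 4 ^ L) := by ring
    rw [e2]
    nlinarith [sq_nonneg (u - 2 * w)]
  · have hlt : cls θ' + 1 ≤ cls θ := by
      by_contra hcon
      have h1 : cls θ + 1 ≤ cls θ' := by omega
      have h2 := Nat.mul_le_mul_right (2 * 4 ^ L) h1
      have := hp θ
      rw [add_mul] at h2
      omega
    have h1 := Nat.mul_le_mul_right (2 * 4 ^ L) hlt
    have h2 : cls θ' * (2 * 4 ^ L) + p θ' + 4 ^ L ≤ cls θ * (2 * 4 ^ L) + p θ := by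
      have := hp θ'
      rw [add_mul] at h1
      omega
    have h3 : ((cls θ' * (2 * 4 ^ L) + p θ' + 4 ^ L : ℕ) : ℝ) ≤
      ((cls θ * (2 * 4 ^ L) + p θ : ℕ) : ℝ) := by exact_mod_cast h2
    rw [le_div_iff₀ h4]
    have h5 := pow_le_pow_left₀ (abs_nonneg _) (θ.abs_ridge_sub_ridge_le_two θ' hx) 2
    rw [sq_abs] at h5
    push_cast at h3 ⊢
    nlinarith

/-! ### Groupings with small diameters -/

/-- Applied with `p = 2 / d`, where `p ≤ 2 / 3` means `d ≥ 3`; the constant is `1 / (1 - p)` at the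
endpoint. The induction step is Bernoulli's inequality for the exponent `1 - p`. -/
lemma sum_rpow_neg_le {p : ℝ} (hp0 : 0 ≤ p) (hp1 : p ≤ 2 / 3) (m : ℕ) :
    ∑ k : Fin m, (((k : ℕ) + 1 : ℕ) : ℝ) ^ (-p) ≤ 3 * (m : ℝ) ^ (1 - p) := by
  induction m with
  | zero => simp; positivity
  | succ m ih =>
    rw [Fin.sum_univ_castSucc]
    simp only [Fin.val_castSucc, Fin.val_last]
    set M : ℝ := ((m + 1 : ℕ) : ℝ) with hM
    have hMpos : 0 < M := by rw [hM]; positivity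
    have hm : (m : ℝ) = M * (1 + -(1 / M)) := by rw [hM]; push_cast; field_simp; ring
    have hM1 : 1 / M ≤ 1 := by
      rw [div_le_one hMpos, hM]; push_cast; linarith [(Nat.cast_nonneg m : (0 : ℝ) ≤ m)]
    have h1 := rpow_one_add_le_one_add_mul_self (s := -(1 / M)) (by linarith) (p := 1 - p)
      (by linarith) (by linarith)
    have h2 : (m : ℝ) ^ (1 - p) ≤ M ^ (1 - p) * (1 + (1 - p) * -(1 / M)) := by
      rw [hm, Real.mul_rpow hMpos.le (by linarith)]
      gcongr
    have h3 : M ^ (1 - p) * (1 / M) = M ^ (-p) := by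
      rw [show (-p) = (1 - p) - 1 by ring, Real.rpow_sub_one hMpos.ne']; ring
    have h4 : 0 < M ^ (-p) := by positivity
    have h5 : (m : ℝ) ^ (1 - p) ≤ M ^ (1 - p) - (1 - p) * M ^ (-p) := by
      rw [← h3]; linarith
    nlinarith

lemma sum_inv_sq_le (m : ℕ) :
    ∑ k : Fin m, ((((k : ℕ) + 1 : ℕ) : ℝ) ^ (-1 : ℝ)) ^ 2 ≤ 2 := by
  rcases m with - | m
  · simp
  have key : ∑ k : Fin (m + 1), ((((k : ℕ) + 1 : ℕ) : ℝ) ^ (-1 : ℝ)) ^ 2 ≤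
      2 - 1 / ((m : ℝ) + 1) := by
    induction m with
    | zero => norm_num
    | succ m ih =>
      rw [Fin.sum_univ_castSucc]
      simp only [Fin.val_castSucc, Fin.val_last]
      have hm : (0 : ℝ) ≤ m := Nat.cast_nonneg m
      have h : (((m + 1 + 1 : ℕ) : ℝ) ^ (-1 : ℝ)) ^ 2 ≤
          1 / ((m : ℝ) + 1) - 1 / (((m + 1 : ℕ) : ℝ) + 1) := by
        rw [Real.rpow_neg_one]
        push_cast
        rw [div_sub_div _ _ (by positivity) (by positivity), inv_pow, inv_eq_one_div,
          div_le_div_iff₀ (by positivity) (by positivity)]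
        nlinarith
      linarith
  have : 0 ≤ 1 / ((m : ℝ) + 1) := by positivity
  linarith

/-- For `d ≥ 2` every family of `m * q` ridge functions splits into `m` groups of `q` whose
squared diameters sum to `O(m ^ (1 - 2 / d))`. -/
lemma exists_grouping {d : ℕ} (hd : 2 ≤ d) {ι : Type*} [Fintype ι] (θ : ι → RidgeParam d)
    {m q : ℕ} (hm : 1 ≤ m) (hq : 0 < q) (hι : Fintype.card ι = m * q) :
    ∃ (g : Fin m → Fin q → ι) (δ : Fin m → ℝ),
      (∀ φ : ι → ℝ, ∑ s, φ s = ∑ k, ∑ i, φ (g k i)) ∧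
      (∀ k i j, ∀ x ∈ cube d, |(θ (g k i)).ridge x - (θ (g k j)).ridge x| ≤ δ k) ∧
      ∑ k, δ k ^ 2 ≤ (3000 * (√m * (m : ℝ) ^ (-(1 / (d : ℝ))))) ^ 2 := by
  have hmpos : (0 : ℝ) < m := by exact_mod_cast hm
  rw [mul_pow, mul_pow, Real.sq_sqrt hmpos.le, ← Real.rpow_natCast ((m : ℝ) ^ (-(1 / (d : ℝ)))) 2,
    ← Real.rpow_mul hmpos.le]
  rcases hd.eq_or_lt with rfl | hd3
  -- Order `m` is chosen only to have `m ≤ 4 ^ m`; then `800 / 4 ^ m * (8 * 4 ^ m + m) ≤ 7200`.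
  · obtain ⟨c, hcB, hc⟩ := exists_holder_code m
    obtain ⟨g, δ, hg, hδ, hsum⟩ := exists_ordered_grouping
      (fun i j x => (θ i).ridge x - (θ j).ridge x) (cube 2) (fun i => c (θ i))
      (by positivity) (fun i j h x hx => hc _ _ h x hx) (fun i j x => abs_sub_comm _ _) hq m
      (8 * 4 ^ m) univ (by rw [Finset.card_univ, hι]) (fun i _ => hcB _)
    refine ⟨g, δ, hg, hδ, hsum.trans ?_⟩
    have h1 : (m : ℝ) * (m : ℝ) ^ (-(1 / ((2 : ℕ) : ℝ)) * ((2 : ℕ) : ℝ)) = 1 := by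
      rw [show (-(1 / ((2 : ℕ) : ℝ)) * ((2 : ℕ) : ℝ)) = -1 by norm_num, Real.rpow_neg_one]
      field_simp
    rw [h1]
    have h2 : (m : ℝ) ≤ 4 ^ m := by
      have : m < 4 ^ m := Nat.lt_pow_self (by norm_num)
      exact_mod_cast this.le
    have h4 : (0 : ℝ) < 4 ^ m := by positivity
    rw [div_mul_eq_mul_div, div_le_iff₀ h4]
    push_cast
    linarith
  · have hd3' : (3 : ℝ) ≤ d := by exact_mod_cast hd3
    obtain ⟨g, hg, hδ⟩ := exists_greedy_grouping (by omega) θ m univ (by rw [Finset.card_univ, hι])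
    refine ⟨g, _, hg, hδ, ?_⟩
    -- The constant 3000 is fixed by `3 * 1728 ^ 2 ≤ 3000 ^ 2`.
    have h1 := sum_rpow_neg_le (p := 2 / d) (by positivity)
      (by gcongr) m
    have e1 : ∀ k : Fin m, (1728 * (((k : ℕ) + 1 : ℕ) : ℝ) ^ (-(1 / (d : ℝ)))) ^ 2 =
        1728 ^ 2 * (((k : ℕ) + 1 : ℕ) : ℝ) ^ (-(2 / (d : ℝ))) := by
      intro k
      rw [mul_pow, ← Real.rpow_natCast (_ ^ _) 2, ← Real.rpow_mul (by positivity)]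
      congr 2
      push_cast; ring
    have e2 : (m : ℝ) * (m : ℝ) ^ (-(1 / (d : ℝ)) * ((2 : ℕ) : ℝ)) = (m : ℝ) ^ (1 - 2 / (d : ℝ)) := by
      rw [show 1 - 2 / (d : ℝ) = 1 + -(1 / (d : ℝ)) * ((2 : ℕ) : ℝ) by push_cast; ring,
        Real.rpow_add hmpos, Real.rpow_one]
    rw [e2, Finset.sum_congr rfl fun k _ => e1 k, ← Finset.mul_sum]
    have h3 : 0 ≤ (m : ℝ) ^ (1 - 2 / (d : ℝ)) := by positivity
    linarith

/-- For `d = 1` every family of `m * q` ridge functions splits into `m` groups of `q` whose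
squared diameters have a bounded sum. -/
lemma exists_grouping_one {ι : Type*} [Fintype ι] (θ : ι → RidgeParam 1)
    {m q : ℕ} (hι : Fintype.card ι = m * q) :
    ∃ (g : Fin m → Fin q → ι) (δ : Fin m → ℝ),
      (∀ φ : ι → ℝ, ∑ s, φ s = ∑ k, ∑ i, φ (g k i)) ∧
      (∀ k i j, ∀ x ∈ cube 1, |(θ (g k i)).ridge x - (θ (g k j)).ridge x| ≤ δ k) ∧
      ∑ k, δ k ^ 2 ≤ 3000 ^ 2 := by
  obtain ⟨g, hg, hδ⟩ := exists_greedy_grouping le_rfl θ m univ (by rw [Finset.card_univ, hι])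
  refine ⟨g, _, hg, hδ, ?_⟩
  have h1 := sum_inv_sq_le m
  simp only [Nat.cast_one, div_one, mul_pow]
  rw [← Finset.mul_sum]
  linarith

end RidgeApprox

namespace RidgeApprox

open Finset MeasureTheory Filter Topology

/-! ### Second order Taylor expansion of Fourier integrals -/

/-- Mean value inequality on the segment from `0` to `u`, where the derivative has norm at most
`|u|`. The sharp factor `1 / 2` is not needed. -/
lemma norm_exp_sub_one_sub_le (u : ℝ) :
    ‖Complex.exp (Complex.I * u) - 1 - Complex.I * u‖ ≤ u ^ 2 := by
  have hderiv : ∀ t : ℝ, HasDerivAt (fun t : ℝ => Complex.exp (Complex.I * t) - 1 - Complex.I * t)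
      (Complex.I * (Complex.exp (Complex.I * t) - 1)) t := by
    intro t
    have h1 : HasDerivAt (fun t : ℝ => Complex.I * (t : ℂ)) (Complex.I * 1) t :=
      (Complex.ofRealCLM.hasDerivAt (x := t)).const_mul Complex.I
    exact ((h1.cexp.sub_const 1).sub h1).congr_deriv (by ring)
  have hbound : ∀ t ∈ Set.uIcc 0 u, ‖Complex.I * (Complex.exp (Complex.I * t) - 1)‖ ≤ |u| := by
    intro t ht
    rw [norm_mul, Complex.norm_I, one_mul]
    refine Real.norm_exp_I_mul_ofReal_sub_one_le.trans ?_
    have := Set.abs_sub_left_of_mem_uIcc ht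
    simpa using this
  have h := (convex_uIcc (0 : ℝ) u).norm_image_sub_le_of_norm_hasDerivWithin_le
    (fun t _ => (hderiv t).hasDerivWithinAt) hbound Set.left_mem_uIcc Set.right_mem_uIcc
  simpa [← sq] using h

variable {d : ℕ} {F : EuclideanSpace ℝ (Fin d) → ℂ}

@[fun_prop]
lemma continuous_l1Norm : Continuous (l1Norm (d := d)) := by
  unfold l1Norm
  fun_prop

lemma norm_le_l1Norm (w : EuclideanSpace ℝ (Fin d)) : ‖w‖ ≤ l1Norm w := by
  rw [EuclideanSpace.norm_eq]
  refine Real.sqrt_le_iff.2 ⟨l1Norm_nonneg w, ?_⟩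
  simp only [Real.norm_eq_abs]
  exact Finset.sum_sq_le_sq_sum_of_nonneg fun i _ => abs_nonneg _

lemma spectralNorm_nonneg (s : ℕ) : 0 ≤ spectralNorm s F :=
  integral_nonneg fun w => mul_nonneg (pow_nonneg (l1Norm_nonneg w) s) (norm_nonneg _)

lemma integrable_spectralDensity_one (hF : Integrable F)
    (h2 : Integrable (spectralDensity 2 F)) : Integrable (fun w => l1Norm w * ‖F w‖) := by
  refine (hF.norm.add h2).mono'
    (continuous_l1Norm.aestronglyMeasurable.mul hF.norm.aestronglyMeasurable) ?_
  refine Eventually.of_forall fun w => ?_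
  have h0 := l1Norm_nonneg w
  rw [Real.norm_of_nonneg (by positivity)]
  simp only [Pi.add_apply, spectralDensity]
  nlinarith [norm_nonneg (F w), mul_nonneg (norm_nonneg (F w)) (sq_nonneg (l1Norm w - 1)),
    mul_nonneg (norm_nonneg (F w)) (sq_nonneg (l1Norm w))]

/-- The real part of the Fourier integral of `F`. -/
noncomputable def fourierRe (F : EuclideanSpace ℝ (Fin d) → ℂ) (x : EuclideanSpace ℝ (Fin d)) : ℝ :=
  ∫ w, (Complex.exp (Complex.I * ((inner ℝ x w : ℝ) : ℂ)) * F w).re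

/-- The gradient at the origin of the real part of the Fourier integral of `F`. -/
noncomputable def fourierGrad (F : EuclideanSpace ℝ (Fin d) → ℂ) : EuclideanSpace ℝ (Fin d) :=
  ∫ w, (-(F w).im) • w

/-- The integrand of the second order Taylor remainder at the origin. -/
noncomputable def remainder (F : EuclideanSpace ℝ (Fin d) → ℂ)
    (w x : EuclideanSpace ℝ (Fin d)) : ℝ :=
  ((Complex.exp (Complex.I * ((inner ℝ x w : ℝ) : ℂ)) - 1 -
    Complex.I * ((inner ℝ x w : ℝ) : ℂ)) * F w).re

lemma integrable_exp_mul (hF : Integrable F) (x : EuclideanSpace ℝ (Fin d)) :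
    Integrable fun w => Complex.exp (Complex.I * ((inner ℝ x w : ℝ) : ℂ)) * F w := by
  refine hF.bdd_mul (c := 1) (Continuous.aestronglyMeasurable (by fun_prop)) ?_
  refine Eventually.of_forall fun w => ?_
  rw [mul_comm, Complex.norm_exp_ofReal_mul_I]

lemma integrable_exp_mul_re (hF : Integrable F) (x : EuclideanSpace ℝ (Fin d)) :
    Integrable fun w => (Complex.exp (Complex.I * ((inner ℝ x w : ℝ) : ℂ)) * F w).re :=
  (integrable_exp_mul hF x).re

lemma integrable_im_smul (hF : Integrable F) (h2 : Integrable (spectralDensity 2 F)) :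
    Integrable fun w => (-(F w).im) • w := by
  refine (integrable_spectralDensity_one hF h2).mono'
    ((Complex.continuous_im.comp_aestronglyMeasurable hF.aestronglyMeasurable).neg.smul
      continuous_id.aestronglyMeasurable) (Eventually.of_forall fun w => ?_)
  rw [norm_smul, norm_neg, mul_comm]
  exact mul_le_mul (norm_le_l1Norm w) (Complex.abs_im_le_norm _) (norm_nonneg _) (l1Norm_nonneg w)

lemma fourierRe_sub_eq (hF : Integrable F) (h2 : Integrable (spectralDensity 2 F))
    (x : EuclideanSpace ℝ (Fin d)) :
    fourierRe F x - fourierRe F 0 - inner ℝ (fourierGrad F) x = ∫ w, remainder F w x := by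
  have h3 := integrable_im_smul hF h2
  have e : (inner ℝ (fourierGrad F) x : ℝ) = ∫ w, (inner ℝ x ((-(F w).im) • w) : ℝ) := by
    rw [integral_inner h3, real_inner_comm]; rfl
  rw [fourierRe, fourierRe, e, ← integral_sub (integrable_exp_mul_re hF x)
    (integrable_exp_mul_re hF 0), ← integral_sub _ (h3.const_inner x)]
  · refine integral_congr_ae (Eventually.of_forall fun w => ?_)
    simp only [remainder, inner_zero_left, inner_smul_right]
    simp [sub_mul, Complex.mul_re]
    ring
  · exact (integrable_exp_mul_re hF x).sub (integrable_exp_mul_re hF 0)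

lemma abs_remainder_le (w : EuclideanSpace ℝ (Fin d)) {x : EuclideanSpace ℝ (Fin d)} {r : ℝ}
    (hx : ∀ i, |x i| ≤ r) : |remainder F w x| ≤ r ^ 2 * spectralDensity 2 F w := by
  rw [remainder]
  refine (Complex.abs_re_le_norm _).trans ?_
  rw [norm_mul, spectralDensity, ← mul_assoc]
  gcongr
  refine (norm_exp_sub_one_sub_le _).trans ?_
  have := abs_inner_le w x hx
  rw [real_inner_comm] at this
  rw [← sq_abs, ← mul_pow, mul_comm r]
  gcongr

lemma abs_fourierRe_sub_le (hF : Integrable F) (h2 : Integrable (spectralDensity 2 F))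
    {x : EuclideanSpace ℝ (Fin d)} {r : ℝ} (hx : ∀ i, |x i| ≤ r) :
    |fourierRe F x - fourierRe F 0 - inner ℝ (fourierGrad F) x| ≤ r ^ 2 * spectralNorm 2 F := by
  rw [fourierRe_sub_eq hF h2, spectralNorm, ← integral_const_mul, ← Real.norm_eq_abs]
  exact norm_integral_le_of_norm_le (h2.const_mul _)
    (Eventually.of_forall fun w => abs_remainder_le w hx)

/-- `f` is controlled only on the cube, whereas `fourierRe F` satisfies the Taylor estimates
everywhere and can replace it there. -/
lemma HasFourierRep.eq_fourierRe {f : EuclideanSpace ℝ (Fin d) → ℝ} (h : HasFourierRep f F)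
    {x : EuclideanSpace ℝ (Fin d)} (hx : x ∈ cube d) : f x = fourierRe F x := by
  have h1 := congrArg Complex.re (h.eq_integral x hx)
  rw [Complex.ofReal_re] at h1
  rw [h1, fourierRe]
  exact (integral_re (integrable_exp_mul h.integrable x)).symm

lemma zero_mem_cube : (0 : EuclideanSpace ℝ (Fin d)) ∈ cube d := fun i => by simp

lemma HasFourierRep.hasGradientAt {f : EuclideanSpace ℝ (Fin d) → ℝ} (h : HasFourierRep f F)
    (h2 : Integrable (spectralDensity 2 F)) : HasGradientAt f (fourierGrad F) 0 := by
  rw [hasGradientAt_iff_isLittleO]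
  have hO : (fun x => f x - f 0 - inner ℝ (fourierGrad F) (x - 0)) =O[𝓝 0]
      fun x => ‖x - 0‖ ^ 2 := by
    refine Asymptotics.IsBigO.of_bound (spectralNorm 2 F) ?_
    filter_upwards [Metric.closedBall_mem_nhds (0 : EuclideanSpace ℝ (Fin d)) one_pos] with x hx
    have hxn : ‖x‖ ≤ 1 := by simpa using hx
    have hxi : ∀ i, |x i| ≤ ‖x‖ := fun i => PiLp.norm_apply_le x i
    have hxc : x ∈ cube d := fun i => abs_le.1 ((hxi i).trans hxn)
    rw [h.eq_fourierRe hxc, h.eq_fourierRe zero_mem_cube, sub_zero, Real.norm_eq_abs, norm_pow,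
      norm_norm, mul_comm]
    exact abs_fourierRe_sub_le h.integrable h2 hxi
  refine hO.trans_isLittleO ?_
  exact Asymptotics.isLittleO_pow_sub_sub 0 one_lt_two

end RidgeApprox

namespace RidgeApprox

open Finset MeasureTheory Filter Topology

/-! ### The integral representation by ridge functions -/

/-- Taylor's formula with integral remainder, by an explicit antiderivative. On `[0, s]` the factor
`s - t` is a ramp. -/
lemma integral_cos_mul_sub {R : ℝ} (hR : R ≠ 0) (φ s : ℝ) :
    ∫ t in (0 : ℝ)..s, Real.cos (R * t + φ) * (s - t) =
      (Real.cos φ - Real.cos (R * s + φ) - R * s * Real.sin φ) / R ^ 2 := by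
  have hderiv : ∀ t ∈ Set.uIcc 0 s, HasDerivAt
      (fun t : ℝ => Real.sin (R * t + φ) / R * (s - t) - Real.cos (R * t + φ) / R ^ 2)
      (Real.cos (R * t + φ) * (s - t)) t := by
    intro t _
    have h1 : HasDerivAt (fun t : ℝ => R * t + φ) R t := by
      simpa using ((hasDerivAt_id t).const_mul R).add_const φ
    have h2 : HasDerivAt (fun t : ℝ => s - t) (-1) t := by
      simpa using (hasDerivAt_id t).const_sub s
    refine (((h1.sin.div_const R).mul h2).sub (h1.cos.div_const (R ^ 2))).congr_deriv ?_
    field_simp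
    ring
  rw [intervalIntegral.integral_eq_sub_of_hasDerivAt hderiv
    (Continuous.intervalIntegrable (by fun_prop) _ _)]
  field_simp
  simp
  ring

lemma relu_of_nonneg {z : ℝ} (hz : 0 ≤ z) : relu z = z := max_eq_right hz

lemma relu_of_nonpos {z : ℝ} (hz : z ≤ 0) : relu z = 0 := max_eq_left hz

@[fun_prop]
lemma continuous_relu : Continuous relu := by
  unfold relu
  fun_prop

lemma integral_cos_mul_relu {R : ℝ} (hR : R ≠ 0) (φ : ℝ) {s : ℝ} (hs0 : 0 ≤ s) (hs1 : s ≤ 1) :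
    ∫ t in (0 : ℝ)..1, Real.cos (R * t + φ) * relu (s - t) =
      (Real.cos φ - Real.cos (R * s + φ) - R * s * Real.sin φ) / R ^ 2 := by
  have hc : Continuous fun t : ℝ => Real.cos (R * t + φ) * relu (s - t) := by fun_prop
  rw [← integral_cos_mul_sub hR, ← intervalIntegral.integral_add_adjacent_intervals (b := s)
    (hc.intervalIntegrable _ _) (hc.intervalIntegrable _ _)]
  have h1 : ∫ t in (0 : ℝ)..s, Real.cos (R * t + φ) * relu (s - t) =
      ∫ t in (0 : ℝ)..s, Real.cos (R * t + φ) * (s - t) := by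
    refine intervalIntegral.integral_congr fun t ht => ?_
    rw [Set.uIcc_of_le hs0] at ht
    simp only [relu_of_nonneg (sub_nonneg.2 ht.2)]
  have h2 : ∫ t in s..1, Real.cos (R * t + φ) * relu (s - t) = ∫ _t in s..1, (0 : ℝ) := by
    refine intervalIntegral.integral_congr fun t ht => ?_
    rw [Set.uIcc_of_le hs1] at ht
    simp only [relu_of_nonpos (sub_nonpos.2 ht.1), mul_zero]
  rw [h1, h2, intervalIntegral.integral_zero, add_zero]

lemma integral_cos_mul_relu_of_nonpos (R φ : ℝ) {s : ℝ} (hs : s ≤ 0) :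
    ∫ t in (0 : ℝ)..1, Real.cos (R * t + φ) * relu (s - t) = 0 := by
  have h : ∫ t in (0 : ℝ)..1, Real.cos (R * t + φ) * relu (s - t) =
      ∫ _t in (0 : ℝ)..1, (0 : ℝ) := by
    refine intervalIntegral.integral_congr fun t ht => ?_
    rw [Set.uIcc_of_le zero_le_one] at ht
    simp only [relu_of_nonpos (by linarith [ht.1] : s - t ≤ 0), mul_zero]
  rw [h, intervalIntegral.integral_zero]

/-- The Taylor remainder of a cosine, as a superposition of ramps. -/
lemma cos_remainder_eq {R : ℝ} (hR : R ≠ 0) (φ : ℝ) {u : ℝ} (hu : |u| ≤ 1) :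
    ∫ t in (0 : ℝ)..1, (-Real.cos (R * t + φ) * relu (u - t) +
        -Real.cos (-R * t + φ) * relu (-u - t)) =
      (Real.cos (R * u + φ) - Real.cos φ + R * u * Real.sin φ) / R ^ 2 := by
  obtain ⟨h1, h2⟩ := abs_le.1 hu
  simp only [neg_mul (Real.cos _)]
  rw [intervalIntegral.integral_add (Continuous.intervalIntegrable (by fun_prop) _ _)
    (Continuous.intervalIntegrable (by fun_prop) _ _), intervalIntegral.integral_neg,
    intervalIntegral.integral_neg]
  -- Only the ramp on the side of the sign of `u` is active; the other integral vanishes.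
  rcases le_total 0 u with h | h
  · rw [integral_cos_mul_relu hR φ h h2, integral_cos_mul_relu_of_nonpos (-R) φ (by linarith)]
    field_simp; ring
  · rw [integral_cos_mul_relu (neg_ne_zero.2 hR) φ (by linarith : 0 ≤ -u) (by linarith),
      integral_cos_mul_relu_of_nonpos R φ h]
    simp only [neg_mul_neg, neg_sq]
    field_simp; ring

/-! ### The closed convex hull of the ridge functions -/

variable {d : ℕ}

lemma isCompact_cube (d : ℕ) : IsCompact (cube d) := by
  have h : cube d = (EuclideanSpace.equiv (Fin d) ℝ) ⁻¹'
      (Set.univ.pi fun _ => Set.Icc (-1 : ℝ) 1) := by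
    ext x; simp [cube, Pi.le_def, forall_and]
  rw [h, ← ContinuousLinearEquiv.coe_toHomeomorph, Homeomorph.isCompact_preimage]
  exact isCompact_univ_pi fun _ => isCompact_Icc

instance (d : ℕ) : CompactSpace (cube d) := isCompact_iff_compactSpace.1 (isCompact_cube d)

/-- A ridge function as a continuous function on the cube. -/
noncomputable def RidgeParam.toContinuousMap (θ : RidgeParam d) : C(cube d, ℝ) where
  toFun x := θ.ridge x
  continuous_toFun := by unfold RidgeParam.ridge; fun_prop

/-- The closed convex hull of the ridge functions. -/
noncomputable def ridgeHull (d : ℕ) : Set C(cube d, ℝ) :=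
  closure (convexHull ℝ (Set.range RidgeParam.toContinuousMap))

lemma convex_ridgeHull : Convex ℝ (ridgeHull d) := (convex_convexHull ℝ _).closure

/-- The ramp `x ↦ (a·x - t)₊` on the cube. -/
noncomputable def rampMap (a : EuclideanSpace ℝ (Fin d)) (t : ℝ) : C(cube d, ℝ) where
  toFun x := relu (inner ℝ a (x : EuclideanSpace ℝ (Fin d)) - t)
  continuous_toFun := by fun_prop

lemma continuous_rampMap (a : EuclideanSpace ℝ (Fin d)) : Continuous (rampMap a) := by
  refine ContinuousMap.continuous_of_continuous_uncurry _ ?_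
  simp only [rampMap, ContinuousMap.coe_mk, Function.uncurry_def]
  fun_prop

lemma smul_rampMap_mem {a : EuclideanSpace ℝ (Fin d)} (ha : l1Norm a = 1) {t : ℝ}
    (ht : t ∈ Set.Icc (0 : ℝ) 1) {c : ℝ} (hc : |c| ≤ 1) : c • rampMap a t ∈ ridgeHull d := by
  obtain ⟨h1, h2⟩ := abs_le.1 hc
  have hp : rampMap a t ∈ ridgeHull d := subset_closure (subset_convexHull ℝ _
    ⟨⟨1, a, t, Or.inr rfl, ha, ht⟩, by
      ext x; simp [RidgeParam.toContinuousMap, RidgeParam.ridge, rampMap]⟩)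
  have hn : -rampMap a t ∈ ridgeHull d := subset_closure (subset_convexHull ℝ _
    ⟨⟨-1, a, t, Or.inl rfl, ha, ht⟩, by
      ext x; simp [RidgeParam.toContinuousMap, RidgeParam.ridge, rampMap]⟩)
  have := convex_ridgeHull hp hn (a := (1 + c) / 2) (b := (1 - c) / 2) (by linarith) (by linarith)
    (by ring)
  convert this using 1
  module

lemma l1Norm_neg (a : EuclideanSpace ℝ (Fin d)) : l1Norm (-a) = l1Norm a := by
  simp [l1Norm]

/-- The second order Taylor remainder of `cos (R a·x + φ)`. -/
noncomputable def cosRemainder (a : EuclideanSpace ℝ (Fin d)) (R φ : ℝ) : C(cube d, ℝ) where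
  toFun x := Real.cos (R * inner ℝ a (x : EuclideanSpace ℝ (Fin d)) + φ) - Real.cos φ +
    R * inner ℝ a (x : EuclideanSpace ℝ (Fin d)) * Real.sin φ
  continuous_toFun := by fun_prop

/-- The remainder divided by `R ^ 2` is the integral over `t ∈ [0, 1]` of two ramps with weights of
modulus at most 1. Halving makes a convex combination, whence the 2 in `v = 2 v_{f,2}`, and a closed
convex set contains its averages. -/
lemma cosRemainder_mem {a : EuclideanSpace ℝ (Fin d)} (ha : l1Norm a = 1) {R : ℝ} (hR : R ≠ 0)
    (φ : ℝ) : (2 * R ^ 2)⁻¹ • cosRemainder a R φ ∈ ridgeHull d := by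
  set J : ℝ → C(cube d, ℝ) := fun t => (1 / 2 : ℝ) • (-Real.cos (R * t + φ)) • rampMap a t +
    (1 / 2 : ℝ) • (-Real.cos (-R * t + φ)) • rampMap (-a) t with hJ
  have hJc : Continuous J := by
    have := continuous_rampMap a
    have := continuous_rampMap (-a)
    fun_prop
  have hJmem : ∀ t ∈ Set.Icc (0 : ℝ) 1, J t ∈ ridgeHull d := by
    intro t ht
    refine convex_ridgeHull (smul_rampMap_mem ha ht ?_)
      (smul_rampMap_mem (by rw [l1Norm_neg, ha]) ht ?_) (by norm_num) (by norm_num) (by norm_num)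
    · rw [abs_neg]; exact Real.abs_cos_le_one _
    · rw [abs_neg]; exact Real.abs_cos_le_one _
  have hprob : IsProbabilityMeasure (volume.restrict (Set.Ioc (0 : ℝ) 1)) := ⟨by simp⟩
  have hint : Integrable J (volume.restrict (Set.Ioc (0 : ℝ) 1)) :=
    (hJc.integrableOn_Icc (a := 0) (b := 1)).mono_set Set.Ioc_subset_Icc_self
  have hmem : ∫ t in Set.Ioc (0 : ℝ) 1, J t ∈ ridgeHull d := by
    refine convex_ridgeHull.integral_mem isClosed_closure ?_ hint
    filter_upwards [ae_restrict_mem measurableSet_Ioc] with t ht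
    exact hJmem t (Set.Ioc_subset_Icc_self ht)
  convert hmem using 1
  ext x
  have e1 : (∫ t in Set.Ioc (0 : ℝ) 1, J t) x = ∫ t in Set.Ioc (0 : ℝ) 1, J t x :=
    ((ContinuousMap.evalCLM ℝ x).integral_comp_comm hint).symm
  have hu : |(inner ℝ a (x : EuclideanSpace ℝ (Fin d)) : ℝ)| ≤ 1 := by
    have := abs_inner_le a (x : EuclideanSpace ℝ (Fin d)) (r := 1) (abs_apply_le_one x.2)
    rwa [ha, one_mul] at this
  have e2 := cos_remainder_eq hR φ hu
  rw [intervalIntegral.integral_of_le zero_le_one] at e2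
  rw [e1]
  have e3 : ∀ t, J t x = (1 / 2 : ℝ) * (-Real.cos (R * t + φ) *
      relu (inner ℝ a (x : EuclideanSpace ℝ (Fin d)) - t) +
        -Real.cos (-R * t + φ) * relu (-inner ℝ a (x : EuclideanSpace ℝ (Fin d)) - t)) := by
    intro t
    simp only [hJ, ContinuousMap.add_apply, ContinuousMap.smul_apply, smul_eq_mul, rampMap,
      ContinuousMap.coe_mk, inner_neg_left]
    ring
  simp only [e3]
  rw [integral_const_mul, e2]
  simp only [cosRemainder, ContinuousMap.smul_apply, ContinuousMap.coe_mk, smul_eq_mul]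
  field_simp

end RidgeApprox

namespace RidgeApprox

open Finset MeasureTheory Filter Topology

/-! ### The Taylor remainder in the hull, and its approximation by averages -/

variable {d : ℕ} {F : EuclideanSpace ℝ (Fin d) → ℂ}

/-- The integrand of the Taylor remainder, as a continuous function on the cube. -/
noncomputable def remainderMap (F : EuclideanSpace ℝ (Fin d) → ℂ) (w : EuclideanSpace ℝ (Fin d)) :
    C(cube d, ℝ) where
  toFun x := remainder F w x
  continuous_toFun := by unfold remainder; fun_prop

/-- Splitting into real and imaginary parts isolates `F`, which is only a.e. strongly measurable,
from maps into `C(cube d, ℝ)` that are continuous in `w`. -/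
lemma aestronglyMeasurable_remainderMap (hF : Integrable F) :
    AEStronglyMeasurable (remainderMap F) := by
  set A : EuclideanSpace ℝ (Fin d) → C(cube d, ℝ) := fun w =>
    ⟨fun x => Real.cos (inner ℝ (x : EuclideanSpace ℝ (Fin d)) w) - 1, by fun_prop⟩ with hA
  set B : EuclideanSpace ℝ (Fin d) → C(cube d, ℝ) := fun w =>
    ⟨fun x => Real.sin (inner ℝ (x : EuclideanSpace ℝ (Fin d)) w) -
      inner ℝ (x : EuclideanSpace ℝ (Fin d)) w, by fun_prop⟩ with hB
  have hAc : Continuous A := by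
    refine ContinuousMap.continuous_of_continuous_uncurry _ ?_
    simp only [hA, ContinuousMap.coe_mk, Function.uncurry_def]
    fun_prop
  have hBc : Continuous B := by
    refine ContinuousMap.continuous_of_continuous_uncurry _ ?_
    simp only [hB, ContinuousMap.coe_mk, Function.uncurry_def]
    fun_prop
  have e : remainderMap F = fun w => (F w).re • A w - (F w).im • B w := by
    funext w
    ext x
    simp only [remainderMap, remainder, hA, hB, ContinuousMap.coe_mk, ContinuousMap.sub_apply,
      ContinuousMap.smul_apply, smul_eq_mul]
    rw [mul_comm Complex.I, Complex.exp_mul_I, ← Complex.ofReal_cos, ← Complex.ofReal_sin]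
    simp only [Complex.mul_re, Complex.sub_re, Complex.sub_im, Complex.add_re, Complex.add_im,
      Complex.ofReal_re, Complex.ofReal_im, Complex.I_re, Complex.I_im, Complex.mul_im,
      Complex.one_re, Complex.one_im]
    ring
  rw [e]
  exact ((Complex.continuous_re.comp_aestronglyMeasurable hF.aestronglyMeasurable).smul
    hAc.aestronglyMeasurable).sub ((Complex.continuous_im.comp_aestronglyMeasurable
      hF.aestronglyMeasurable).smul hBc.aestronglyMeasurable)

lemma integrable_remainderMap (hF : Integrable F) (h2 : Integrable (spectralDensity 2 F)) :
    Integrable (remainderMap F) := by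
  refine h2.mono' (aestronglyMeasurable_remainderMap hF) (Eventually.of_forall fun w => ?_)
  have h0 : 0 ≤ spectralDensity 2 F w :=
    mul_nonneg (pow_nonneg (l1Norm_nonneg w) 2) (norm_nonneg _)
  refine (ContinuousMap.norm_le _ h0).2 fun x => ?_
  have := abs_remainder_le (F := F) w (r := 1) (abs_apply_le_one x.2)
  rw [one_pow, one_mul] at this
  exact this

lemma l1Norm_smul (c : ℝ) (a : EuclideanSpace ℝ (Fin d)) : l1Norm (c • a) = |c| * l1Norm a := by
  simp [l1Norm, abs_mul, Finset.mul_sum]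

/-- In polar form `Re (exp (i u) F) = ‖F‖ cos (u + arg F)`; the phase of `F` becomes that of the
cosine. -/
lemma remainderMap_eq_smul {w : EuclideanSpace ℝ (Fin d)} (hw : l1Norm w ≠ 0) :
    remainderMap F w = ‖F w‖ • cosRemainder ((l1Norm w)⁻¹ • w) (l1Norm w) (F w).arg := by
  ext x
  simp only [remainderMap, remainder, cosRemainder, ContinuousMap.coe_mk, ContinuousMap.smul_apply,
    smul_eq_mul, inner_smul_left, map_inv₀]
  have e : l1Norm w * ((starRingEnd ℝ (l1Norm w))⁻¹ * inner ℝ w (x : EuclideanSpace ℝ (Fin d))) =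
      inner ℝ (x : EuclideanSpace ℝ (Fin d)) w := by
    rw [real_inner_comm w]
    simp only [conj_trivial]
    field_simp
  rw [e]
  set u : ℝ := inner ℝ (x : EuclideanSpace ℝ (Fin d)) w
  have h1 : (F w).re = ‖F w‖ * Real.cos (F w).arg := (Complex.norm_mul_cos_arg _).symm
  have h2 : (F w).im = ‖F w‖ * Real.sin (F w).arg := (Complex.norm_mul_sin_arg _).symm
  rw [mul_comm Complex.I, Complex.exp_mul_I, ← Complex.ofReal_cos, ← Complex.ofReal_sin,
    Real.cos_add]
  simp only [Complex.mul_re, Complex.sub_re, Complex.sub_im, Complex.add_re, Complex.add_im,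
    Complex.ofReal_re, Complex.ofReal_im, Complex.I_re, Complex.I_im, Complex.mul_im,
    Complex.one_re, Complex.one_im]
  rw [h1, h2]
  ring

/-- Otherwise a continuous functional would separate the point from the hull. Its bound on each
`cosRemainder`, weighted by `2 ‖w‖₁ ^ 2 ‖F w‖` and integrated, contradicts the separation.
Frequencies of zero norm have no direction but contribute nothing. -/
lemma integral_remainderMap_mem (hF : Integrable F) (h2 : Integrable (spectralDensity 2 F))
    (hν : 0 < spectralNorm 2 F) :
    (2 * spectralNorm 2 F)⁻¹ • ∫ w, remainderMap F w ∈ ridgeHull d := by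
  by_contra hnot
  obtain ⟨ℓ, u, hlt, hgt⟩ := geometric_hahn_banach_closed_point convex_ridgeHull
    isClosed_closure hnot
  have hint := integrable_remainderMap hF h2
  have h1 : ℓ (∫ w, remainderMap F w) ≤ 2 * spectralNorm 2 F * u := by
    rw [← ℓ.integral_comp_comm hint, spectralNorm, mul_assoc, mul_comm _ u, ← mul_assoc,
      ← integral_const_mul]
    refine integral_mono (ℓ.integrable_comp hint) (h2.const_mul _) fun w => ?_
    simp only [spectralDensity]
    rcases eq_or_ne (l1Norm w) 0 with h0 | h0
    · have hw : w = 0 := norm_le_zero_iff.1 ((norm_le_l1Norm w).trans h0.le)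
      have : remainderMap F w = 0 := by
        ext x; simp [remainderMap, remainder, hw]
      rw [this, map_zero, h0]; simp
    · have ha : l1Norm ((l1Norm w)⁻¹ • w) = 1 := by
        rw [l1Norm_smul, abs_of_nonneg (inv_nonneg.2 (l1Norm_nonneg w)), inv_mul_cancel₀ h0]
      have h3 := (hlt _ (cosRemainder_mem ha h0 (F w).arg)).le
      rw [map_smul, smul_eq_mul] at h3
      rw [remainderMap_eq_smul h0, map_smul, smul_eq_mul]
      have hpos : 0 < 2 * l1Norm w ^ 2 := by positivity
      rw [inv_mul_le_iff₀ hpos] at h3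
      have := mul_le_mul_of_nonneg_left h3 (norm_nonneg (F w))
      linarith
  rw [map_smul, smul_eq_mul, lt_inv_mul_iff₀ (by positivity)] at hgt
  linarith

lemma nonempty_ridgeParam (hd : 1 ≤ d) : Nonempty (RidgeParam d) :=
  ⟨⟨1, EuclideanSpace.single ⟨0, hd⟩ 1, 0, Or.inr rfl, by
    simp only [l1Norm, PiLp.single_apply]
    rw [Finset.sum_eq_single ⟨0, hd⟩] <;> simp +contextual, by simp⟩⟩

/-- Elements of the closed convex hull are uniform limits of averages. -/
lemma exists_average_of_mem_ridgeHull (hd : 1 ≤ d) {y : C(cube d, ℝ)} (hy : y ∈ ridgeHull d)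
    {ε : ℝ} (hε : 0 < ε) {m : ℕ} (hm : 1 ≤ m) :
    ∃ q, 0 < q ∧ ∃ (ι : Type) (_ : Fintype ι) (θ : ι → RidgeParam d), Fintype.card ι = m * q ∧
      ∀ x : cube d, |y x - (∑ i, (θ i).ridge x) / (m * q : ℕ)| ≤ ε := by
  classical
  obtain ⟨θ₀⟩ := nonempty_ridgeParam hd
  -- Half of `ε` pays for passing to a finite convex combination, the other half for making its
  -- weights multiples of `1 / M`.
  obtain ⟨z, hz, hyz⟩ := Metric.mem_closure_iff.1 hy (ε / 2) (by positivity)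
  obtain ⟨κ, _, w, p, hw0, hw1, hp, hsum⟩ := mem_convexHull_iff_exists_fintype.1 hz
  choose θ hθ using hp
  set N : ℕ := Fintype.card κ with hN
  obtain ⟨q, hq⟩ := exists_nat_gt (4 * N / ε)
  have hq0 : (0 : ℝ) < q := lt_of_le_of_lt (by positivity) hq
  have hqpos : 0 < q := by exact_mod_cast hq0
  set M : ℕ := m * q with hM
  have hqM : (q : ℝ) ≤ M := by exact_mod_cast Nat.le_mul_of_pos_left q hm
  have hMpos : (0 : ℝ) < M := by linarith
  have hNM : 2 * N / M ≤ ε / 2 := by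
    rw [div_lt_iff₀ hε] at hq
    rw [div_le_iff₀ hMpos]
    nlinarith
  -- The `i`-th ramp is repeated `n i` times; at most `N` places stay free and are filled with an
  -- arbitrary ramp. Both errors are at most `N / M`.
  set n : κ → ℕ := fun i => ⌊w i * M⌋₊ with hn
  have hn1 : ∀ i, (n i : ℝ) ≤ w i * M := fun i => Nat.floor_le (mul_nonneg (hw0 i) hMpos.le)
  have hn2 : ∀ i, w i * M < n i + 1 := fun i => Nat.lt_floor_add_one _
  have hsumn : ((∑ i, n i : ℕ) : ℝ) ≤ M := by
    push_cast
    calc ∑ i, (n i : ℝ) ≤ ∑ i, w i * M := Finset.sum_le_sum fun i _ => hn1 i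
      _ = M := by rw [← Finset.sum_mul, hw1, one_mul]
  have hsumn' : ∑ i, n i ≤ M := by exact_mod_cast hsumn
  set r : ℕ := M - ∑ i, n i with hr
  have hrN : (r : ℝ) ≤ N := by
    rw [hr, Nat.cast_sub hsumn']
    have : (M : ℝ) ≤ ∑ i, ((n i : ℝ) + 1) := by
      calc (M : ℝ) = ∑ i, w i * M := by rw [← Finset.sum_mul, hw1, one_mul]
        _ ≤ _ := Finset.sum_le_sum fun i _ => (hn2 i).le
    rw [Finset.sum_add_distrib] at this
    push_cast
    simp only [Finset.sum_const, Finset.card_univ, nsmul_eq_mul, mul_one] at this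
    linarith
  refine ⟨q, hqpos, (Σ i : κ, Fin (n i)) ⊕ Fin r, inferInstance,
    Sum.elim (fun s => θ s.1) fun _ => θ₀, ?_, fun x => ?_⟩
  · simp only [Fintype.card_sum, Fintype.card_sigma, Fintype.card_fin]
    omega
  · have hz' : z x = ∑ i, w i * (θ i).ridge x := by
      rw [← hsum]
      simp only [ContinuousMap.coe_sum, Finset.sum_apply, ContinuousMap.smul_apply, smul_eq_mul]
      refine Finset.sum_congr rfl fun i _ => ?_
      rw [← hθ i]; rfl
    have h1 : |y x - z x| ≤ ε / 2 := by
      rw [← Real.dist_eq]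
      exact (ContinuousMap.dist_apply_le_dist x).trans hyz.le
    have h2 : |z x - (∑ i : (Σ i : κ, Fin (n i)) ⊕ Fin r,
        (Sum.elim (fun s => θ s.1) (fun _ => θ₀) i : RidgeParam d).ridge x) / (M : ℕ)| ≤ ε / 2 := by
      refine le_trans ?_ hNM
      have e : z x - (∑ i : (Σ i : κ, Fin (n i)) ⊕ Fin r,
          (Sum.elim (fun s => θ s.1) (fun _ => θ₀) i : RidgeParam d).ridge x) / (M : ℕ) =
          (∑ i, (w i * M - n i) * (θ i).ridge x - r * θ₀.ridge x) / M := by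
        rw [Fintype.sum_sum_type, Fintype.sum_sigma, hz']
        simp only [Sum.elim_inl, Sum.elim_inr, Finset.sum_const, Finset.card_univ,
          Fintype.card_fin, nsmul_eq_mul, sub_mul, Finset.sum_sub_distrib]
        have : ∑ i, w i * M * (θ i).ridge x = M * ∑ i, w i * (θ i).ridge x := by
          rw [Finset.mul_sum]; exact Finset.sum_congr rfl fun i _ => by ring
        rw [this]
        field_simp
        ring
      rw [e, abs_div, abs_of_pos hMpos]
      gcongr
      refine (abs_sub _ _).trans ?_
      have b1 : |∑ i, (w i * M - n i) * (θ i).ridge x| ≤ N := by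
        refine (Finset.abs_sum_le_sum_abs _ _).trans
          ((Finset.sum_le_card_nsmul _ _ 1 fun i _ => ?_).trans_eq (by simp [hN]))
        rw [abs_mul, abs_of_nonneg (by linarith [hn1 i])]
        exact mul_le_one₀ (by linarith [hn2 i]) (abs_nonneg _) ((θ i).abs_ridge_le x.2)
      have b2 : |(r : ℝ) * θ₀.ridge x| ≤ N := by
        rw [abs_mul, Nat.abs_cast]
        have := mul_le_mul_of_nonneg_left (θ₀.abs_ridge_le x.2) (Nat.cast_nonneg (α := ℝ) r)
        linarith
      linarith
    calc _ ≤ |y x - z x| + |z x - _| := abs_sub_le _ _ _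
      _ ≤ ε / 2 + ε / 2 := add_le_add h1 h2
      _ = ε := by ring

/-- The Taylor remainder of `f` is uniformly approximated by `2 v_{f,2}` times averages of ridge
functions. -/
lemma exists_average (hd : 1 ≤ d) {f : EuclideanSpace ℝ (Fin d) → ℝ} (h : HasFourierRep f F)
    (h2 : Integrable (spectralDensity 2 F)) {η : ℝ} (hη : 0 < η) {m : ℕ} (hm : 1 ≤ m) :
    ∃ q, 0 < q ∧ ∃ (ι : Type) (_ : Fintype ι) (θ : ι → RidgeParam d), Fintype.card ι = m * q ∧
      ∀ x ∈ cube d, |f x - f 0 - inner ℝ (fourierGrad F) x -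
        2 * spectralNorm 2 F * ((∑ i, (θ i).ridge x) / (m * q : ℕ))| ≤
          2 * spectralNorm 2 F * η := by
  rcases (spectralNorm_nonneg (F := F) 2).eq_or_lt with hν | hν
  · obtain ⟨θ₀⟩ := nonempty_ridgeParam hd
    refine ⟨1, one_pos, Fin m, inferInstance, fun _ => θ₀, by simp, fun x hx => ?_⟩
    rw [← hν, mul_zero, zero_mul, zero_mul, sub_zero, h.eq_fourierRe hx,
      h.eq_fourierRe zero_mem_cube]
    have := abs_fourierRe_sub_le h.integrable h2 (abs_apply_le_one hx)
    rwa [← hν, mul_zero] at this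
  · obtain ⟨q, hq, ι, hι, θ, hcard, hθ⟩ := exists_average_of_mem_ridgeHull hd
      (integral_remainderMap_mem h.integrable h2 hν) hη hm
    refine ⟨q, hq, ι, hι, θ, hcard, fun x hx => ?_⟩
    have h3 := hθ ⟨x, hx⟩
    have e1 : (∫ w, remainderMap F w) ⟨x, hx⟩ = ∫ w, remainder F w x :=
      ((ContinuousMap.evalCLM ℝ (⟨x, hx⟩ : cube d)).integral_comp_comm
        (integrable_remainderMap h.integrable h2)).symm
    rw [ContinuousMap.smul_apply, e1, smul_eq_mul, ← fourierRe_sub_eq h.integrable h2,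
      ← h.eq_fourierRe hx, ← h.eq_fourierRe zero_mem_cube] at h3
    have h4 := mul_le_mul_of_nonneg_left h3 (by positivity : 0 ≤ 2 * spectralNorm 2 F)
    rw [← abs_of_nonneg (by positivity : 0 ≤ 2 * spectralNorm 2 F), ← abs_mul, mul_sub,
      abs_of_nonneg (by positivity : 0 ≤ 2 * spectralNorm 2 F),
      mul_inv_cancel_left₀ (by positivity)] at h4
    exact h4

end RidgeApprox

namespace RidgeApprox

open Finset MeasureTheory Filter Topology

/-! ### Piecewise linear interpolation on the line -/

/-- The slope increments, at the nodes `j h`, of the piecewise linear interpolant of `φ` with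
initial slope `p`. -/
noncomputable def slopeJump (φ : ℝ → ℝ) (p h : ℝ) : ℕ → ℝ
  | 0 => (φ h - φ 0 - p * h) / h
  | j + 1 => (φ ((j + 1) * h + h) - 2 * φ ((j + 1) * h) + φ ((j + 1) * h - h)) / h

section Interpolation

variable {φ : ℝ → ℝ} {p h ν : ℝ}

lemma abs_slopeJump_le (hh : 0 < h) (h0 : ∀ z, |φ z - φ 0 - p * z| ≤ ν * z ^ 2)
    (h2 : ∀ s z, |φ (s + z) - 2 * φ s + φ (s - z)| ≤ ν * z ^ 2) (j : ℕ) :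
    |slopeJump φ p h j| ≤ ν * h := by
  rcases j with - | j
  · rw [slopeJump, abs_div, abs_of_pos hh, div_le_iff₀ hh]
    exact (h0 h).trans_eq (by ring)
  · rw [slopeJump, abs_div, abs_of_pos hh, div_le_iff₀ hh]
    exact (h2 _ h).trans_eq (by ring)

/-- The jumps telescope: on the `j`-th interval, where the first `j + 1` ramps are active, the sum
is the chord of `φ`. -/
lemma sum_slopeJump (hh : 0 < h) (j : ℕ) (x : ℝ) :
    φ 0 + p * x + ∑ i ∈ range (j + 1), slopeJump φ p h i * (x - i * h) =
      φ (j * h) + (x - j * h) * ((φ (j * h + h) - φ (j * h)) / h) := by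
  induction j with
  | zero =>
    simp [slopeJump]
    field_simp
    ring
  | succ j ih =>
    rw [Finset.sum_range_succ, ← add_assoc, ih, slopeJump]
    have e : ((j : ℝ) + 1) * h - h = j * h := by ring
    have e' : ((j : ℝ) + 1) * h = j * h + h := by ring
    push_cast
    rw [e, e']
    field_simp
    ring

/-- Interpolation reproduces affine functions, so it suffices to expand at the evaluation point; the
error is a convex combination of the two endpoint remainders. -/
lemma abs_interpolation_sub_le (hh : 0 < h)
    (h1 : ∀ s, ∃ D, ∀ z, |φ (s + z) - φ s - D * z| ≤ ν * z ^ 2) {y τ : ℝ} (hτ0 : 0 ≤ τ)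
    (hτ : τ ≤ h) :
    |φ (y + τ) - (φ y + τ * ((φ (y + h) - φ y) / h))| ≤ ν * h ^ 2 := by
  obtain ⟨D, hD⟩ := h1 (y + τ)
  have a1 := hD (-τ)
  have a2 := hD (h - τ)
  rw [show y + τ + -τ = y by ring] at a1
  rw [show y + τ + (h - τ) = y + h by ring] at a2
  have hν : 0 ≤ ν := by
    have := (abs_nonneg _).trans (hD 1)
    linarith
  set e1 := φ y - φ (y + τ) - D * -τ
  set e2 := φ (y + h) - φ (y + τ) - D * (h - τ)
  have e : φ (y + τ) - (φ y + τ * ((φ (y + h) - φ y) / h)) =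
      -((1 - τ / h) * e1 + τ / h * e2) := by
    simp only [e1, e2]; field_simp; ring
  have hl0 : 0 ≤ τ / h := by positivity
  have hl1 : τ / h ≤ 1 := (div_le_one hh).2 hτ
  have b1 : |e1| ≤ ν * h ^ 2 := a1.trans (by rw [neg_sq]; gcongr)
  have b2 : |e2| ≤ ν * h ^ 2 := a2.trans (by gcongr; linarith)
  rw [e, abs_neg]
  calc _ ≤ |(1 - τ / h) * e1| + |τ / h * e2| := abs_add_le _ _
    _ = (1 - τ / h) * |e1| + τ / h * |e2| := by
        rw [abs_mul, abs_mul, abs_of_nonneg hl0, abs_of_nonneg (sub_nonneg.2 hl1)]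
    _ ≤ (1 - τ / h) * (ν * h ^ 2) + τ / h * (ν * h ^ 2) := by
        gcongr
    _ = _ := by ring

/-- The range extends one mesh beyond `n h`. There the missing ramp at `n h` is worth at most `ν h ^
2`, hence the factor 2; this leeway lets `m` ramps cover both half-lines for either parity. -/
lemma abs_sub_rampSum_le (hh : 0 < h) (h0 : ∀ z, |φ z - φ 0 - p * z| ≤ ν * z ^ 2)
    (h1 : ∀ s, ∃ D, ∀ z, |φ (s + z) - φ s - D * z| ≤ ν * z ^ 2)
    (h2 : ∀ s z, |φ (s + z) - 2 * φ s + φ (s - z)| ≤ ν * z ^ 2) {n : ℕ} {x : ℝ} (hx0 : 0 ≤ x)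
    (hx : x ≤ (n + 1) * h) :
    |φ x - (φ 0 + p * x + ∑ i ∈ range n, slopeJump φ p h i * relu (x - i * h))| ≤
      2 * ν * h ^ 2 := by
  obtain ⟨j, hjn, hj1, hj2⟩ : ∃ j ≤ n, (j : ℝ) * h ≤ x ∧ x ≤ (j + 1) * h := by
    rcases le_or_gt (n * h) x with h' | h'
    · exact ⟨n, le_rfl, h', hx⟩
    · refine ⟨⌊x / h⌋₊, ?_, ?_, ?_⟩
      · have h3 : x / h < n := (div_lt_iff₀ hh).2 h'
        have h4 := (Nat.floor_le (by positivity : 0 ≤ x / h)).trans_lt h3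
        exact_mod_cast h4.le
      · rw [← le_div_iff₀ hh]; exact Nat.floor_le (by positivity)
      · rw [← div_le_iff₀ hh]; exact (Nat.lt_floor_add_one _).le
  have hsum : ∑ i ∈ range (n + 1), slopeJump φ p h i * relu (x - i * h) =
      ∑ i ∈ range (j + 1), slopeJump φ p h i * (x - i * h) := by
    rw [← Finset.sum_subset (Finset.range_mono (show j + 1 ≤ n + 1 by omega))]
    · refine Finset.sum_congr rfl fun i hi => ?_
      have hij : (i : ℝ) ≤ j := by exact_mod_cast Nat.lt_succ_iff.1 (Finset.mem_range.1 hi)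
      rw [relu_of_nonneg (by nlinarith)]
    · intro i _ hi
      have hij : (j : ℝ) + 1 ≤ i := by
        have : j + 1 ≤ i := by simpa using hi
        exact_mod_cast this
      rw [relu_of_nonpos (by nlinarith), mul_zero]
  have hlast : |slopeJump φ p h n * relu (x - n * h)| ≤ ν * h ^ 2 := by
    rw [abs_mul, abs_of_nonneg (relu_nonneg _), sq, ← mul_assoc]
    exact mul_le_mul (abs_slopeJump_le hh h0 h2 n) (max_le hh.le (by linarith)) (relu_nonneg _)
      ((abs_nonneg _).trans (abs_slopeJump_le hh h0 h2 n))
  have hint := abs_interpolation_sub_le hh h1 (y := j * h) (τ := x - j * h) (by linarith)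
    (by linarith)
  rw [show (j : ℝ) * h + (x - j * h) = x by ring, ← sum_slopeJump (p := p) hh, ← hsum,
    Finset.sum_range_succ] at hint
  have e : φ x - (φ 0 + p * x + ∑ i ∈ range n, slopeJump φ p h i * relu (x - i * h)) =
      φ x - (φ 0 + p * x + (∑ i ∈ range n, slopeJump φ p h i * relu (x - i * h) +
        slopeJump φ p h n * relu (x - n * h))) + slopeJump φ p h n * relu (x - n * h) := by ring
  rw [e]
  refine (abs_add_le _ _).trans ?_
  linarith

end Interpolation

/-! ### Taylor estimates at arbitrary base points -/

variable {d : ℕ} {F : EuclideanSpace ℝ (Fin d) → ℂ}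

/-- The density of the translate by `x` of the Fourier integral of `F`. -/
noncomputable def modulate (F : EuclideanSpace ℝ (Fin d) → ℂ) (x w : EuclideanSpace ℝ (Fin d)) :
    ℂ :=
  Complex.exp (Complex.I * ((inner ℝ x w : ℝ) : ℂ)) * F w

lemma spectralDensity_modulate (s : ℕ) (x : EuclideanSpace ℝ (Fin d)) :
    spectralDensity s (modulate F x) = spectralDensity s F := by
  funext w
  rw [spectralDensity, spectralDensity, modulate, norm_mul, mul_comm Complex.I,
    Complex.norm_exp_ofReal_mul_I, one_mul]

/-- Translation multiplies the density by a phase, which leaves the spectral norm unchanged;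
estimates at the origin thus hold at every base point. -/
lemma fourierRe_modulate (x z : EuclideanSpace ℝ (Fin d)) :
    fourierRe (modulate F x) z = fourierRe F (x + z) := by
  simp only [fourierRe, modulate]
  congr 1
  funext w
  rw [← mul_assoc, ← Complex.exp_add, inner_add_left]
  congr 3
  push_cast
  ring

lemma abs_fourierRe_add_sub_le (hF : Integrable F) (h2 : Integrable (spectralDensity 2 F))
    (x : EuclideanSpace ℝ (Fin d)) {z : EuclideanSpace ℝ (Fin d)} {r : ℝ} (hz : ∀ i, |z i| ≤ r) :
    |fourierRe F (x + z) - fourierRe F x - inner ℝ (fourierGrad (modulate F x)) z| ≤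
      spectralNorm 2 F * r ^ 2 := by
  have h := abs_fourierRe_sub_le (F := modulate F x) (integrable_exp_mul hF x)
    (by rwa [spectralDensity_modulate]) hz
  rwa [fourierRe_modulate, fourierRe_modulate, add_zero, spectralNorm, spectralDensity_modulate,
    ← spectralNorm, mul_comm] at h

/-- Adding two first order estimates would give `2 ν r ^ 2`. Through `2 - 2 cos u ≤ u ^ 2` the
constant is `ν`, which is what keeps the outer weights in `[-1, 1]` with `v = 2 ν` and mesh `2 / m`.
-/
lemma abs_second_difference_zero_le (hF : Integrable F) (h2 : Integrable (spectralDensity 2 F))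
    {z : EuclideanSpace ℝ (Fin d)} {r : ℝ} (hz : ∀ i, |z i| ≤ r) :
    |fourierRe F z - 2 * fourierRe F 0 + fourierRe F (-z)| ≤ spectralNorm 2 F * r ^ 2 := by
  have hint : ∀ x, Integrable fun w => remainder F w x := by
    intro x
    have h3 := ((integrable_exp_mul_re hF x).sub (integrable_exp_mul_re hF 0)).sub
      ((integrable_im_smul hF h2).const_inner x)
    refine h3.congr (Eventually.of_forall fun w => ?_)
    simp only [remainder, Pi.sub_apply, inner_zero_left, inner_smul_right]
    simp [sub_mul, Complex.mul_re]
    ring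
  have e1 := fourierRe_sub_eq hF h2 z
  have e2 := fourierRe_sub_eq hF h2 (-z)
  rw [inner_neg_right] at e2
  have e3 : fourierRe F z - 2 * fourierRe F 0 + fourierRe F (-z) =
      ∫ w, (remainder F w z + remainder F w (-z)) := by
    rw [integral_add (hint z) (hint (-z))]; linarith
  rw [e3, spectralNorm, mul_comm, ← integral_const_mul, ← Real.norm_eq_abs]
  refine norm_integral_le_of_norm_le (h2.const_mul _) (Eventually.of_forall fun w => ?_)
  set u : ℝ := inner ℝ z w with hu
  have e4 : remainder F w z + remainder F w (-z) = (2 * Real.cos u - 2) * (F w).re := by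
    simp only [remainder, inner_neg_left, ← hu]
    rw [mul_comm Complex.I, mul_comm Complex.I, Complex.exp_mul_I, Complex.exp_mul_I,
      ← Complex.ofReal_cos, ← Complex.ofReal_sin, ← Complex.ofReal_cos, ← Complex.ofReal_sin,
      Real.cos_neg, Real.sin_neg]
    simp only [Complex.mul_re, Complex.sub_re, Complex.sub_im, Complex.add_re, Complex.add_im,
      Complex.ofReal_re, Complex.ofReal_im, Complex.I_re, Complex.I_im, Complex.mul_im,
      Complex.one_re, Complex.one_im]
    ring
  have hc1 := Real.one_sub_sq_div_two_le_cos (x := u)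
  have hc2 := Real.cos_le_one u
  have hul : |u| ≤ l1Norm w * r := by
    rw [hu, real_inner_comm]; exact abs_inner_le w z hz
  have hul2 : u ^ 2 ≤ (l1Norm w * r) ^ 2 := by
    rw [← sq_abs]; exact pow_le_pow_left₀ (abs_nonneg _) hul 2
  rw [Real.norm_eq_abs, e4, abs_mul, abs_of_nonpos (by linarith)]
  calc -(2 * Real.cos u - 2) * |(F w).re| ≤ (l1Norm w * r) ^ 2 * ‖F w‖ :=
        mul_le_mul (by linarith) (Complex.abs_re_le_norm _) (abs_nonneg _) (sq_nonneg _)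
    _ = _ := by rw [spectralDensity]; ring

lemma abs_second_difference_le (hF : Integrable F) (h2 : Integrable (spectralDensity 2 F))
    (x : EuclideanSpace ℝ (Fin d)) {z : EuclideanSpace ℝ (Fin d)} {r : ℝ} (hz : ∀ i, |z i| ≤ r) :
    |fourierRe F (x + z) - 2 * fourierRe F x + fourierRe F (x - z)| ≤
      spectralNorm 2 F * r ^ 2 := by
  have h := abs_second_difference_zero_le (F := modulate F x) (integrable_exp_mul hF x)
    (by rwa [spectralDensity_modulate]) hz
  rwa [fourierRe_modulate, fourierRe_modulate, fourierRe_modulate, add_zero, ← sub_eq_add_neg,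
    spectralNorm, spectralDensity_modulate, ← spectralNorm] at h

end RidgeApprox

namespace RidgeApprox

open Finset MeasureTheory Filter Topology

/-! ### Approximation by networks with signs as outer weights -/

variable {d : ℕ} {F : EuclideanSpace ℝ (Fin d) → ℂ} {f : EuclideanSpace ℝ (Fin d) → ℝ}

/-- Groupings with small diameters yield networks with outer weights `±1`. -/
lemma exists_signed_network (hd : 1 ≤ d) (h : HasFourierRep f F)
    (h2 : Integrable (spectralDensity 2 F)) {m : ℕ} (hm : 1 ≤ m) {σ : ℝ}
    (hσm : √m * (m : ℝ) ^ (-(1 / (d : ℝ))) ≤ σ)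
    (hgroup : ∀ (ι : Type) (_ : Fintype ι) (θ : ι → RidgeParam d) (q : ℕ), 0 < q →
      Fintype.card ι = m * q → ∃ (g : Fin m → Fin q → ι) (δ : Fin m → ℝ),
      (∀ φ : ι → ℝ, ∑ s, φ s = ∑ k, ∑ i, φ (g k i)) ∧
      (∀ k i j, ∀ x ∈ cube d, |(θ (g k i)).ridge x - (θ (g k j)).ridge x| ≤ δ k) ∧
      ∑ k, δ k ^ 2 ≤ σ ^ 2) :
    ∃ (b : Fin m → ℝ) (a : Fin m → EuclideanSpace ℝ (Fin d)) (t : Fin m → ℝ),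
      (∀ k, b k = -1 ∨ b k = 1) ∧ (∀ k, l1Norm (a k) = 1) ∧ (∀ k, t k ∈ Set.Icc (0 : ℝ) 1) ∧
      ∀ x ∈ cube d, |f x - rampNet (f 0) (fourierGrad F) (2 * spectralNorm 2 F) b a t x| ≤
        48 * spectralNorm 2 F * √((d : ℝ) + Real.log m) * (σ / m) := by
  have hm' : (1 : ℝ) ≤ m := by exact_mod_cast hm
  have hd' : (1 : ℝ) ≤ d := by exact_mod_cast hd
  have hmpos : (0 : ℝ) < m := by linarith
  have hσ0 : 0 < σ := lt_of_lt_of_le (by positivity) hσm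
  have hS : 0 < √((d : ℝ) + Real.log m) :=
    Real.sqrt_pos.2 (by linarith [Real.log_nonneg hm'])
  set S := √((d : ℝ) + Real.log m)
  set ν := spectralNorm 2 F with hν
  have hν0 : 0 ≤ ν := spectralNorm_nonneg 2
  -- The averaging error is matched to the selection error: `2 + 2 * 23 = 48`.
  obtain ⟨q, hq, ι, hι, θ, hcard, hθ⟩ := exists_average hd h h2 (η := S * (σ / m))
    (by positivity) hm
  obtain ⟨g, δ, hg, hδ, hsum⟩ := hgroup ι hι θ q hq hcard
  obtain ⟨ω, hω⟩ := exists_selection hd hm hq (fun k i => θ (g k i)) δ hδ hsum hσm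
  refine ⟨fun k => (θ (g k (ω k))).sign, fun k => (θ (g k (ω k))).dir,
    fun k => (θ (g k (ω k))).offset, fun k => (θ _).sign_eq, fun k => (θ _).dir_eq,
    fun k => (θ _).offset_mem, fun x hx => ?_⟩
  have hq' : (0 : ℝ) < q := by exact_mod_cast hq
  have e : f x - rampNet (f 0) (fourierGrad F) (2 * ν) (fun k => (θ (g k (ω k))).sign)
      (fun k => (θ (g k (ω k))).dir) (fun k => (θ (g k (ω k))).offset) x =
      (f x - f 0 - inner ℝ (fourierGrad F) x -
        2 * ν * ((∑ i, (θ i).ridge x) / (m * q : ℕ))) -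
      2 * ν / m * ∑ k, groupDev (fun i => θ (g k i)) (ω k) x := by
    rw [hg fun i => (θ i).ridge x]
    simp only [rampNet, groupDev, Finset.sum_sub_distrib, ← Finset.mul_sum, RidgeParam.ridge]
    push_cast
    field_simp
    ring
  rw [e]
  refine (abs_sub _ _).trans ?_
  have b1 := hθ x hx
  have b2 : |2 * ν / m * ∑ k, groupDev (fun i => θ (g k i)) (ω k) x| ≤
      2 * ν / m * (23 * S * σ) := by
    rw [abs_mul, abs_of_nonneg (by positivity)]
    exact mul_le_mul_of_nonneg_left (hω x hx) (by positivity)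
  calc _ ≤ 2 * ν * (S * (σ / m)) + 2 * ν / m * (23 * S * σ) := add_le_add b1 b2
    _ = _ := by ring

lemma exists_signed_network_of_two_le (hd : 2 ≤ d) (h : HasFourierRep f F)
    (h2 : Integrable (spectralDensity 2 F)) {m : ℕ} (hm : 1 ≤ m) :
    ∃ (b : Fin m → ℝ) (a : Fin m → EuclideanSpace ℝ (Fin d)) (t : Fin m → ℝ),
      (∀ k, b k = -1 ∨ b k = 1) ∧ (∀ k, l1Norm (a k) = 1) ∧ (∀ k, t k ∈ Set.Icc (0 : ℝ) 1) ∧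
      ∀ x ∈ cube d, |f x - rampNet (f 0) (fourierGrad F) (2 * spectralNorm 2 F) b a t x| ≤
        144000 * spectralNorm 2 F * √((d : ℝ) + Real.log m) *
          (m : ℝ) ^ (-(1 / 2 : ℝ) - 1 / (d : ℝ)) := by
  have hmpos : (0 : ℝ) < m := by exact_mod_cast hm
  have hpos : 0 ≤ √m * (m : ℝ) ^ (-(1 / (d : ℝ))) := by positivity
  obtain ⟨b, a, t, hb, ha, ht, hx⟩ := exists_signed_network (by omega) h h2 hm
    (σ := 3000 * (√m * (m : ℝ) ^ (-(1 / (d : ℝ))))) (by linarith)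
    (fun ι _ θ q hq hc => exists_grouping hd θ hm hq hc)
  refine ⟨b, a, t, hb, ha, ht, fun x hxc => (hx x hxc).trans_eq ?_⟩
  have e : √m * (m : ℝ) ^ (-(1 / (d : ℝ))) / m = (m : ℝ) ^ (-(1 / 2 : ℝ) - 1 / (d : ℝ)) := by
    rw [Real.sqrt_eq_rpow, ← Real.rpow_add hmpos, ← Real.rpow_sub_one hmpos.ne']
    congr 1; ring
  rw [← e]
  ring

/-- Here `σ = 3000` does not decay with `m`; the resulting `m ^ (-1)` still beats the required `m ^
(-5/6)`. -/
lemma exists_signed_network_one {F : EuclideanSpace ℝ (Fin 1) → ℂ}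
    {f : EuclideanSpace ℝ (Fin 1) → ℝ} (h : HasFourierRep f F)
    (h2 : Integrable (spectralDensity 2 F)) {m : ℕ} (hm : 1 ≤ m) :
    ∃ (b : Fin m → ℝ) (a : Fin m → EuclideanSpace ℝ (Fin 1)) (t : Fin m → ℝ),
      (∀ k, b k = -1 ∨ b k = 1) ∧ (∀ k, l1Norm (a k) = 1) ∧ (∀ k, t k ∈ Set.Icc (0 : ℝ) 1) ∧
      ∀ x ∈ cube 1, |f x - rampNet (f 0) (fourierGrad F) (2 * spectralNorm 2 F) b a t x| ≤
        144000 * spectralNorm 2 F * √(((1 : ℕ) : ℝ) + Real.log m) * (m : ℝ) ^ (-1 : ℝ) := by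
  have hm' : (1 : ℝ) ≤ m := by exact_mod_cast hm
  have hmpos : (0 : ℝ) < m := by linarith
  have hle : √m * (m : ℝ) ^ (-(1 / ((1 : ℕ) : ℝ))) ≤ 3000 := by
    rw [Nat.cast_one, div_one, Real.sqrt_eq_rpow, ← Real.rpow_add hmpos]
    exact (Real.rpow_le_one_of_one_le_of_nonpos hm' (by norm_num)).trans (by norm_num)
  obtain ⟨b, a, t, hb, ha, ht, hx⟩ := exists_signed_network le_rfl h h2 hm hle
    (fun ι _ θ q _ hc => exists_grouping_one θ hc)
  refine ⟨b, a, t, hb, ha, ht, fun x hxc => (hx x hxc).trans_eq ?_⟩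
  rw [Real.rpow_neg_one]
  ring

/-! ### Approximation on the line with bounded outer weights -/

lemma exists_bounded_network_one {F : EuclideanSpace ℝ (Fin 1) → ℂ}
    {f : EuclideanSpace ℝ (Fin 1) → ℝ} (h : HasFourierRep f F)
    (h2 : Integrable (spectralDensity 2 F)) {m : ℕ} (hm : 1 ≤ m) :
    ∃ (b : Fin m → ℝ) (a : Fin m → EuclideanSpace ℝ (Fin 1)) (t : Fin m → ℝ),
      (∀ k, b k ∈ Set.Icc (-1 : ℝ) 1) ∧ (∀ k, l1Norm (a k) = 1) ∧
      (∀ k, t k ∈ Set.Icc (0 : ℝ) 1) ∧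
      ∀ x ∈ cube 1, |f x - rampNet (f 0) (fourierGrad F) (2 * spectralNorm 2 F) b a t x| ≤
        8 * spectralNorm 2 F * (m : ℝ) ^ (-2 : ℝ) := by
  -- `n₁` ramps point right and `n₂` left. For both, `2 n ≤ m + 1` keeps the nodes `j * H`, `j < n`,
  -- in `[0, 1]`, and `m ≤ 2 (n + 1)` gives `1 ≤ (n + 1) * H`.
  obtain ⟨n₁, n₂, hmn, hn₁, hn₂, hn₁', hn₂'⟩ : ∃ n₁ n₂, m = n₁ + n₂ ∧ m ≤ 2 * (n₁ + 1) ∧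
      m ≤ 2 * (n₂ + 1) ∧ 2 * n₁ ≤ m + 1 ∧ 2 * n₂ ≤ m + 1 :=
    ⟨(m + 1) / 2, m / 2, by omega, by omega, by omega, by omega, by omega⟩
  have hmpos : (0 : ℝ) < m := by exact_mod_cast hm
  set ν := spectralNorm 2 F with hν
  have hν0 : 0 ≤ ν := spectralNorm_nonneg 2
  set s : ℝ → EuclideanSpace ℝ (Fin 1) := fun z => EuclideanSpace.single 0 z with hs
  set φ : ℝ → ℝ := fun z => fourierRe F (s z) with hφ
  set p : ℝ := fourierGrad F 0 with hp
  set H : ℝ := 2 / m with hH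
  have hHpos : 0 < H := by positivity
  have hs0 : s 0 = 0 := by ext i; simp [hs]
  have hsadd : ∀ y z, s (y + z) = s y + s z := fun y z => by ext i; simp [hs]; split_ifs <;> simp
  have hssub : ∀ y z, s (y - z) = s y - s z := fun y z => by ext i; simp [hs]; split_ifs <;> simp
  have habs : ∀ z i, |s z i| ≤ |z| := fun z i => by
    rw [Subsingleton.elim i 0]; simp [hs]
  have hinner : ∀ (G : EuclideanSpace ℝ (Fin 1)) z, (inner ℝ G (s z) : ℝ) = G 0 * z := fun G z => by
    rw [inner_eq_sum]; simp [hs]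
  have h0 : ∀ z, |φ z - φ 0 - p * z| ≤ ν * z ^ 2 := fun z => by
    have := abs_fourierRe_sub_le h.integrable h2 (habs z)
    rw [hinner, sq_abs, mul_comm (z ^ 2)] at this
    simpa only [hφ, hs0] using this
  have h1 : ∀ y, ∃ D, ∀ z, |φ (y + z) - φ y - D * z| ≤ ν * z ^ 2 := fun y =>
    ⟨_, fun z => by
      have := abs_fourierRe_add_sub_le h.integrable h2 (s y) (habs z)
      rw [hinner, sq_abs, ← hsadd] at this
      exact this⟩
  have h3 : ∀ y z, |φ (y + z) - 2 * φ y + φ (y - z)| ≤ ν * z ^ 2 := fun y z => by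
    have := abs_second_difference_le h.integrable h2 (s y) (habs z)
    rw [sq_abs, ← hsadd, ← hssub] at this
    exact this
  set ψ : ℝ → ℝ := fun z => φ (-z) with hψ
  have k0 : ∀ z, |ψ z - ψ 0 - -p * z| ≤ ν * z ^ 2 := fun z => by
    have := h0 (-z)
    simp only [hψ, neg_zero]
    rwa [neg_sq, mul_neg, ← neg_mul] at this
  have k1 : ∀ y, ∃ D, ∀ z, |ψ (y + z) - ψ y - D * z| ≤ ν * z ^ 2 := fun y => by
    obtain ⟨D, hD⟩ := h1 (-y)
    refine ⟨-D, fun z => ?_⟩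
    have := hD (-z)
    rw [neg_sq, mul_neg, ← neg_mul, ← neg_add] at this
    exact this
  have k3 : ∀ y z, |ψ (y + z) - 2 * ψ y + ψ (y - z)| ≤ ν * z ^ 2 := fun y z => by
    have := h3 (-y) (-z)
    rw [neg_sq, ← neg_add, ← neg_sub'] at this
    exact this
  have hcoef : ∀ c : ℝ, |c| ≤ ν * H → c / (ν * H) ∈ Set.Icc (-1 : ℝ) 1 := by
    intro c hc
    refine abs_le.1 ?_
    rw [abs_div, abs_of_nonneg (by positivity : 0 ≤ ν * H)]
    exact div_le_one_of_le₀ hc (by positivity)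
  -- The mesh `H = 2 / m` makes `v / m` equal to `ν H`, the bound on the slope jumps. If `ν H = 0`,
  -- all jumps vanish and the quotient is immaterial.
  have hcancel : ∀ c : ℝ, |c| ≤ ν * H → 2 * ν / m * (c / (ν * H)) = c := by
    intro c hc
    have e : 2 * ν / m = ν * H := by rw [hH]; ring
    rw [e]
    rcases eq_or_ne (ν * H) 0 with h' | h'
    · rw [h'] at hc ⊢
      rw [abs_nonpos_iff.1 hc]; simp
    · exact mul_div_cancel₀ c h'
  have hnode : ∀ n : ℕ, 2 * n ≤ m + 1 → ∀ j : Fin n, (j : ℝ) * H ∈ Set.Icc (0 : ℝ) 1 := by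
    intro n hn j
    refine ⟨by positivity, ?_⟩
    rw [hH, ← mul_div_assoc, div_le_one hmpos]
    have : j.val * 2 ≤ m := by have := j.2; omega
    exact_mod_cast this
  have hreach : ∀ n : ℕ, m ≤ 2 * (n + 1) → 1 ≤ ((n : ℝ) + 1) * H := by
    intro n hn
    rw [hH, ← mul_div_assoc, one_le_div hmpos]
    have : (m : ℝ) ≤ ((2 * (n + 1) : ℕ) : ℝ) := by exact_mod_cast hn
    push_cast at this; linarith
  have hcp := fun j => abs_slopeJump_le (φ := φ) (p := p) hHpos h0 h3 j
  have hcn := fun j => abs_slopeJump_le (φ := ψ) (p := -p) hHpos k0 k3 j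
  have hl1 : l1Norm (s 1) = 1 := by simp [l1Norm, hs]
  have hl1' : l1Norm (s (-1)) = 1 := by simp [l1Norm, hs]
  have hbound : 2 * ν * H ^ 2 = 8 * ν * (m : ℝ) ^ (-2 : ℝ) := by
    rw [hH, Real.rpow_neg hmpos.le, Real.rpow_two]; field_simp; ring
  clear_value H
  subst hmn
  refine ⟨Fin.append (fun j => slopeJump φ p H j / (ν * H)) (fun j => slopeJump ψ (-p) H j / (ν * H)),
    Fin.append (fun _ => s 1) (fun _ => s (-1)),
    Fin.append (fun j => (j : ℕ) * H) (fun j => (j : ℕ) * H), ?_, ?_, ?_, ?_⟩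
  · refine Fin.addCases (fun j => ?_) fun j => ?_
    · rw [Fin.append_left]; exact hcoef _ (hcp j)
    · rw [Fin.append_right]; exact hcoef _ (hcn j)
  · refine Fin.addCases (fun j => ?_) fun j => ?_
    · rw [Fin.append_left]; exact hl1
    · rw [Fin.append_right]; exact hl1'
  · refine Fin.addCases (fun j => ?_) fun j => ?_
    · rw [Fin.append_left]; exact hnode _ hn₁' j
    · rw [Fin.append_right]; exact hnode _ hn₂' j
  · intro x hx
    obtain ⟨z, rfl⟩ : ∃ z, x = s z := ⟨x 0, by ext i; rw [Subsingleton.elim i 0]; simp [hs]⟩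
    have hz := hx 0
    have hz0 : s z 0 = z := by simp [hs]
    rw [hz0] at hz
    have e : rampNet (f 0) (fourierGrad F) (2 * ν)
        (Fin.append (fun j : Fin n₁ => slopeJump φ p H j / (ν * H))
          (fun j : Fin n₂ => slopeJump ψ (-p) H j / (ν * H)))
        (Fin.append (fun _ => s 1) (fun _ => s (-1)))
        (Fin.append (fun j => (j : ℕ) * H) (fun j => (j : ℕ) * H)) (s z) =
        φ 0 + p * z + ∑ i ∈ range n₁, slopeJump φ p H i * relu (z - i * H) +
          ∑ i ∈ range n₂, slopeJump ψ (-p) H i * relu (-z - i * H) := by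
      rw [rampNet, Fin.sum_univ_add, hinner, h.eq_fourierRe zero_mem_cube, mul_add,
        Finset.mul_sum, Finset.mul_sum, ← Fin.sum_univ_eq_sum_range
          (fun i => slopeJump φ p H i * relu (z - i * H)), ← Fin.sum_univ_eq_sum_range
          (fun i => slopeJump ψ (-p) H i * relu (-z - i * H))]
      simp only [Fin.append_left, Fin.append_right, hinner, hφ, hs0, add_assoc]
      congr 2
      congr 1
      · refine Finset.sum_congr rfl fun i _ => ?_
        rw [← mul_assoc, hcancel _ (hcp i)]; simp [hs, hφ]
      · refine Finset.sum_congr rfl fun i _ => ?_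
        rw [← mul_assoc, hcancel _ (hcn i)]; simp [hs, hφ, hψ]
    rw [e, h.eq_fourierRe hx, ← hbound]
    change |φ z - _| ≤ _
    rcases le_total 0 z with hzs | hzs
    · have hzero : ∑ i ∈ range n₂, slopeJump ψ (-p) H i * relu (-z - i * H) = 0 :=
        Finset.sum_eq_zero fun i _ => by
          rw [relu_of_nonpos, mul_zero]
          have : 0 ≤ (i : ℝ) * H := by positivity
          linarith
      rw [hzero, add_zero]
      exact abs_sub_rampSum_le hHpos h0 h1 h3 hzs (hz.2.trans (hreach _ hn₁))
    · have hzero : ∑ i ∈ range n₁, slopeJump φ p H i * relu (z - i * H) = 0 :=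
        Finset.sum_eq_zero fun i _ => by
          rw [relu_of_nonpos, mul_zero]
          have : 0 ≤ (i : ℝ) * H := by positivity
          linarith
      rw [hzero, add_zero]
      have := abs_sub_rampSum_le hHpos k0 k1 k3 (x := -z) (by linarith)
        ((by linarith [hz.1] : -z ≤ 1).trans (hreach _ hn₂))
      simp only [hψ, neg_neg, neg_zero, neg_mul_neg] at this
      exact this

end RidgeApprox

/-! ### The approximation theorem -/

theorem theorem2 :
    ∃ c : ℝ, 0 < c ∧
      ∀ (d : ℕ), 1 ≤ d →
      ∀ (f : EuclideanSpace ℝ (Fin d) → ℝ) (F : EuclideanSpace ℝ (Fin d) → ℂ),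
        RidgeApprox.HasFourierRep f F →
        MeasureTheory.Integrable (RidgeApprox.spectralDensity 2 F) →
        DifferentiableAt ℝ f 0 ∧
        ∃ v : ℝ, 0 ≤ v ∧ v ≤ 2 * RidgeApprox.spectralNorm 2 F ∧
          ∀ m : ℕ, 1 ≤ m →
            (∃ (b : Fin m → ℝ) (a : Fin m → EuclideanSpace ℝ (Fin d)) (t : Fin m → ℝ),
              (∀ k, b k ∈ Set.Icc (-1 : ℝ) 1) ∧
              (∀ k, RidgeApprox.l1Norm (a k) = 1) ∧
              (∀ k, t k ∈ Set.Icc (0 : ℝ) 1) ∧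
              ∀ x ∈ RidgeApprox.cube d,
                |f x - RidgeApprox.rampNet (f 0) (gradient f 0) v b a t x| ≤
                  c * RidgeApprox.spectralNorm 2 F * Real.sqrt ((d : ℝ) + Real.log (m : ℝ)) *
                    (m : ℝ) ^ (-(1 / 2 : ℝ) - 1 / (d : ℝ))) ∧
            (∃ (b : Fin m → ℝ) (a : Fin m → EuclideanSpace ℝ (Fin d)) (t : Fin m → ℝ),
              (∀ k, b k = -1 ∨ b k = 1) ∧
              (∀ k, RidgeApprox.l1Norm (a k) = 1) ∧
              (∀ k, t k ∈ Set.Icc (0 : ℝ) 1) ∧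
              ∀ x ∈ RidgeApprox.cube d,
                |f x - RidgeApprox.rampNet (f 0) (gradient f 0) v b a t x| ≤
                  c * RidgeApprox.spectralNorm 2 F * Real.sqrt ((d : ℝ) + Real.log (m : ℝ)) *
                    (m : ℝ) ^ (-(1 / 2 : ℝ) - 1 / ((d : ℝ) + 2))) := by

  -- `144000 = 48 * 3000`: selection constant times grouping constant.
  refine ⟨144000, by norm_num, fun d hd f F h h2 => ?_⟩
  have hgrad := h.hasGradientAt h2
  refine ⟨hgrad.differentiableAt, 2 * RidgeApprox.spectralNorm 2 F,
    mul_nonneg zero_le_two (RidgeApprox.spectralNorm_nonneg 2), le_rfl, fun m hm => ?_⟩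
  rw [hgrad.gradient]
  have hm' : (1 : ℝ) ≤ m := by exact_mod_cast hm
  have hd' : (1 : ℝ) ≤ d := by exact_mod_cast hd
  have hν := RidgeApprox.spectralNorm_nonneg (F := F) 2
  have hsign : ∀ z : ℝ, z = -1 ∨ z = 1 → z ∈ Set.Icc (-1 : ℝ) 1 := by
    rintro z (rfl | rfl) <;> norm_num
  rcases hd.eq_or_lt with rfl | hd2
  · have hS : 1 ≤ √(((1 : ℕ) : ℝ) + Real.log m) :=
      Real.one_le_sqrt.2 (by push_cast; linarith [Real.log_nonneg hm'])
    constructor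
    · obtain ⟨b, a, t, hb, ha, ht, hx⟩ := RidgeApprox.exists_bounded_network_one h h2 hm
      refine ⟨b, a, t, hb, ha, ht, fun x hxc => (hx x hxc).trans ?_⟩
      have h1 : (m : ℝ) ^ (-2 : ℝ) ≤ (m : ℝ) ^ (-(1 / 2 : ℝ) - 1 / ((1 : ℕ) : ℝ)) :=
        Real.rpow_le_rpow_of_exponent_le hm' (by norm_num)
      have h3 : 8 * RidgeApprox.spectralNorm 2 F ≤
          144000 * RidgeApprox.spectralNorm 2 F * √(((1 : ℕ) : ℝ) + Real.log m) := by
        nlinarith [mul_nonneg hν (sub_nonneg.2 hS)]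
      exact mul_le_mul h3 h1 (by positivity) (by positivity)
    · obtain ⟨b, a, t, hb, ha, ht, hx⟩ := RidgeApprox.exists_signed_network_one h h2 hm
      refine ⟨b, a, t, hb, ha, ht, fun x hxc => (hx x hxc).trans ?_⟩
      exact mul_le_mul_of_nonneg_left
        (Real.rpow_le_rpow_of_exponent_le hm' (by norm_num)) (by positivity)
  -- For `d ≥ 2` weights `±1` already reach the exponent of the first claim, so one network serves
  -- both.
  · obtain ⟨b, a, t, hb, ha, ht, hx⟩ := RidgeApprox.exists_signed_network_of_two_le hd2 h h2 hm
    refine ⟨⟨b, a, t, fun k => hsign _ (hb k), ha, ht, hx⟩,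
      ⟨b, a, t, hb, ha, ht, fun x hxc => (hx x hxc).trans ?_⟩⟩
    refine mul_le_mul_of_nonneg_left (Real.rpow_le_rpow_of_exponent_le hm' ?_) (by positivity)
    have : 1 / ((d : ℝ) + 2) ≤ 1 / d := by gcongr; linarith
    linarith
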